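/- Let $r \ge 2$. An $r$-graph is a set of $r$-element subsets (edges) of a finite vertex set; $\alpha(H)$ denotes the maximum size of a set of vertices of $H$ containing no edge (an independent set). An $r$-graph $H$ has independent neighborhoods if for every set $R$ of $r-1$ vertices the set $\{v \notin R : R \cup \{v\} \in H\}$ is independent. Let $T_r$ be the $r$-graph with vertex set $R \cup S$, where $R \cap S = \emptyset$, $|R| = r$, $|S| = r-1$, whose edges are all $r$-subsets of $R \cup S$ containing $S$, together with $R$. Let $K_t^{(r)}$ be the complete $r$-graph on $t$ vertices, and let $R(T_r, K_t^{(r)})$ be the minimum $N$ such that every red-blue coloring of the edges of $K_N^{(r)}$ contains a red $T_r$ or a blue $K_t^{(r)}$. 1. An $r$-graph has independent neighborhoods if and only if it contains no copy of $T_r$ as a (not necessarily induced) subgraph. 2. There is a constant $c > 0$, depending only on $r$, such that every $n$-vertex $r$-graph $H$ with independent neighborhoods satisfies $$\alpha(H) \ge c\,(n \log n)^{1/r}$$ (where $n\log n$ is read as $0$ for $n=0$). 3. Consequently $R(T_r, K_t^{(r)})$ exists for every $t \ge 2$ and $R(T_r, K_t^{(r)}) = O(t^r/\log t)$; that is, there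 is a constant $C > 0$, depending only on $r$, such that $R(T_r, K_t^{(r)}) \le C\, t^r/\log t$ for all $t \ge 2$. -/

import Mathlib

namespace Hypergraph

/-- `H` is an `r`-graph: it has finitely many vertices and every edge has exactly `r` elements. -/
def IsRGraph {α : Type*} (r : ℕ) (H : Hypergraph α) : Prop :=
  V(H).Finite ∧ ∀ e ∈ E(H), e.ncard = r

/-- `Z` is a set of vertices of `H` containing no edge of `H`. -/
def IsIndepSet {α : Type*} (H : Hypergraph α) (Z : Set α) : Prop :=
  Z ⊆ V(H) ∧ ∀ e ∈ E(H), ¬ e ⊆ Z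

/-- The independence number `α(H)`: the maximum size of an independent set
(used only for hypergraphs with finitely many vertices). -/
noncomputable def indepNum {α : Type*} (H : Hypergraph α) : ℕ :=
  sSup {k : ℕ | ∃ Z : Set α, H.IsIndepSet Z ∧ Z.ncard = k}

/-- The neighborhood of a vertex set `R`: the union of the sets `e \ R` over the edges `e ⊇ R`. -/
def nbhd {α : Type*} (H : Hypergraph α) (R : Set α) : Set α :=
  {v | ∃ e ∈ E(H), R ⊆ e ∧ v ∈ e \ R}

/-- The neighborhood of every set of `r - 1` vertices is independent (for an `r`-graph, `r ≥ 1`). -/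
def HasIndepNbhds {α : Type*} (r : ℕ) (H : Hypergraph α) : Prop :=
  ∀ R : Set α, R ⊆ V(H) → R.ncard = r - 1 → H.IsIndepSet (H.nbhd R)

/-- `H` contains a copy of `F` as a (not necessarily induced) subgraph. -/
def Contains {α β : Type*} (H : Hypergraph α) (F : Hypergraph β) : Prop :=
  ∃ f : β → α, Set.InjOn f V(F) ∧ V(F.image f) ⊆ V(H) ∧ E(F.image f) ⊆ E(H)

/-- The `r`-graph `T_r`: its vertex set is the disjoint union of a set `R` of size `r`
(the left summand) and a set `S` of size `r - 1` (the right summand), and its edges are all the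
`r`-sets containing `S`, together with `R`. -/
def T (r : ℕ) : Hypergraph (Fin r ⊕ Fin (r - 1)) where
  vertexSet := Set.univ
  edgeSet := {e | e.ncard = r ∧ Set.range Sum.inr ⊆ e} ∪ {Set.range Sum.inl}
  subset_vertexSet_of_mem_edgeSet' := fun _ _ => Set.subset_univ _

/-- The complete `r`-graph `K_N^{(r)}` on `N` vertices. -/
def completeRGraph (r N : ℕ) : Hypergraph (Fin N) where
  vertexSet := Set.univ
  edgeSet := {e | e.ncard = r}
  subset_vertexSet_of_mem_edgeSet' := fun _ _ => Set.subset_univ _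

/-- The subgraph of all edges that receive colour `i`, on the same vertex set. -/
def colorClass {α κ : Type*} (H : Hypergraph α) (c : E(H) → κ) (i : κ) : Hypergraph α where
  vertexSet := V(H)
  edgeSet := {e | ∃ he : e ∈ E(H), c ⟨e, he⟩ = i}
  subset_vertexSet_of_mem_edgeSet' := fun _ he => he.1.subset_vertexSet

/-- The set of `N` such that every red-blue coloring (`true` is red, `false` is blue) of the edges
of `K_N^{(r)}` has a red copy of `F` or a blue copy of `G`. -/
def ramseySet {β γ : Type*} (r : ℕ) (F : Hypergraph β) (G : Hypergraph γ) : Set ℕ :=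
  {N | ∀ c : E(completeRGraph r N) → Bool,
    ((completeRGraph r N).colorClass c true).Contains F ∨
    ((completeRGraph r N).colorClass c false).Contains G}

/-- The Ramsey number `R(F, G)` of two `r`-graphs, the minimum of `ramseySet r F G`
(meaningful when that set is nonempty). -/
noncomputable def ramseyNumber {β γ : Type*} (r : ℕ) (F : Hypergraph β) (G : Hypergraph γ) : ℕ :=
  sInf (ramseySet r F G)

end Hypergraph

/-!
Let `r = b + 1` and let `a` be the independence number. Independent neighborhoods bound the
codegree of every set of `b` vertices by `a`.

Take a random vertex set `U`, containing each vertex with probability `p`, a vertex `v ∉ U`, and a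
uniformly random independent subset `W` of `U`. If no edge inside `U` meets the vertex set of the
link of `v` twice, then, once `W` is fixed outside that vertex set, the rest of `W` is a uniformly
random subset of a fixed set. By the Harris–Kleitman inequality, `W ∪ {v}` is independent with
probability at least `q ^ M`, where `q = 1 - (1/2) ^ b` and `M` counts the link edges available.
Bounding this convex function of `M` by its tangent line and averaging shows that the sum over `v`
of these extension probabilities is at least `exp (-L) * ((1 + L) * n / 4 - κ * a ^ b * a)` for
every `L ≥ 0`. On the other hand, trading `(U, v)` for `(U ∪ {v}, v)` bounds it by `2 * a / p`, as
an independent set has at most `a` elements. If `a` were much smaller than `(n log n) ^ (1 / r)`,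
then `p` could be taken so that `exp L * a / p` is small compared to `n` with `L` of order `log n`,
and comparing the two bounds gives `n log n = O(a ^ r)`.

For `r = 2` the graph is triangle-free and the condition on the link always holds. For `r ≥ 3` it
fails with probability at most `1 / 2`, by a union bound over the edges `e₁, e₂` through `v` and `f`
that violate it.
-/

namespace FinsetFamily

open Finset
open scoped BigOperators

section IndepSets

variable {α : Type*} [DecidableEq α] {E : Finset (Finset α)} {U W N Y S : Finset α} {v : α}

/-- The independent subsets of `U` in the set family `E`: those containing no member of `E`. -/
def indepSets (E : Finset (Finset α)) (U : Finset α) : Finset (Finset α) :=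
  {W ∈ U.powerset | ∀ e ∈ E, ¬ e ⊆ W}

/-- The part of the link of `v` inside `W`. A link edge is represented by the member of `E` it
comes from, that is, with `v` still in it. -/
def linkIn (E : Finset (Finset α)) (v : α) (W : Finset α) : Finset (Finset α) :=
  {e ∈ E | v ∈ e ∧ e.erase v ⊆ W}

/-- The vertices covered by the part of the link of `v` inside `U`. -/
def linkVerts (E : Finset (Finset α)) (U : Finset α) (v : α) : Finset α :=
  (linkIn E v U).biUnion fun e => e.erase v

/-- The link of `v` inside `U` is spread thinly over the other edges: every edge inside `U` meets
its vertex set at most once. Under this condition the vertices of the link that are compatible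
with a given independent set outside it can be added freely, in any combination. -/
def LocallySparse (E : Finset (Finset α)) (U : Finset α) (v : α) : Prop :=
  ∀ f ∈ E, f ⊆ U → #(f ∩ linkVerts E U v) ≤ 1

instance : Decidable (LocallySparse E U v) :=
  inferInstanceAs (Decidable (∀ f ∈ E, f ⊆ U → #(f ∩ linkVerts E U v) ≤ 1))

/-- The vertices of `N` that can be added to `Y` without completing a member of `E`. -/
def freeVerts (E : Finset (Finset α)) (N Y : Finset α) : Finset α :=
  {x ∈ N | ∀ e ∈ E, ¬ e ⊆ insert x Y}

theorem mem_indepSets : W ∈ indepSets E U ↔ W ⊆ U ∧ ∀ e ∈ E, ¬ e ⊆ W := by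
  simp [indepSets]

theorem mem_linkIn {e : Finset α} : e ∈ linkIn E v W ↔ e ∈ E ∧ v ∈ e ∧ e.erase v ⊆ W := by
  simp [linkIn]

theorem indepSets_nonempty (hE : ∅ ∉ E) : (indepSets E U).Nonempty :=
  ⟨∅, mem_indepSets.2 ⟨empty_subset _, fun _ he h => hE (subset_empty.1 h ▸ he)⟩⟩

theorem linkVerts_subset : linkVerts E U v ⊆ U :=
  biUnion_subset.2 fun _ he => (mem_linkIn.1 he).2.2

theorem insert_mem_indepSets_iff (hW : W ⊆ U) :
    insert v W ∈ indepSets E (insert v U) ↔ W ∈ indepSets E U ∧ linkIn E v W = ∅ := by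
  simp only [mem_indepSets, linkIn, filter_eq_empty_iff, not_and, hW, true_and,
    insert_subset_insert, ← forall₂_and]
  refine forall₂_congr fun e _ => ⟨fun h => ⟨fun he => h (he.trans (subset_insert _ _)),
    fun _ he => h (subset_insert_iff.2 he)⟩, fun ⟨h, h'⟩ he => ?_⟩
  by_cases hve : v ∈ e
  · exact h' hve (subset_insert_iff.1 he)
  · exact h ((subset_insert_iff_of_notMem hve).1 he)

theorem filter_notMem_indepSets_insert (hv : v ∉ U) :
    {W ∈ indepSets E (insert v U) | v ∉ W} = indepSets E U := by
  ext W
  simp only [mem_filter, mem_indepSets]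
  exact ⟨fun ⟨⟨hW, h⟩, hvW⟩ => ⟨(subset_insert_iff_of_notMem hvW).1 hW, h⟩,
    fun ⟨hW, h⟩ => ⟨⟨hW.trans (subset_insert _ _), h⟩, fun hvW => hv (hW hvW)⟩⟩

theorem card_filter_mem_indepSets_insert (hv : v ∉ U) :
    #{W ∈ indepSets E (insert v U) | v ∈ W} = #{W ∈ indepSets E U | linkIn E v W = ∅} := by
  have hsub {W} (hW : W ∈ indepSets E U) : W ⊆ U := (mem_indepSets.1 hW).1
  refine card_bij' (fun W _ => W.erase v) (fun W _ => insert v W) ?_ ?_ ?_ ?_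
  · intro W hW
    obtain ⟨hW, hvW⟩ := mem_filter.1 hW
    rw [mem_filter, ← insert_mem_indepSets_iff (subset_insert_iff.1 (mem_indepSets.1 hW).1),
      insert_erase hvW]
    exact hW
  · intro W hW
    have hW := mem_filter.1 hW
    exact mem_filter.2 ⟨(insert_mem_indepSets_iff (hsub hW.1)).2 hW, mem_insert_self _ _⟩
  · exact fun W hW => insert_erase (mem_filter.1 hW).2
  · exact fun W hW => erase_insert fun hvW => hv (hsub (mem_filter.1 hW).1 hvW)

theorem union_mem_indepSets_iff (hN : N ⊆ U) (hEN : ∀ f ∈ E, f ⊆ U → #(f ∩ N) ≤ 1)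
    (hY : Y ⊆ U \ N) (hS : S ⊆ N) :
    Y ∪ S ∈ indepSets E U ↔ Y ∈ indepSets E (U \ N) ∧ S ⊆ freeVerts E N Y := by
  have hYS : Y ∪ S ⊆ U := union_subset (hY.trans sdiff_subset) (hS.trans hN)
  simp only [mem_indepSets, hYS, hY, true_and]
  refine ⟨fun h => ⟨fun e he h' => h e he (h'.trans subset_union_left), fun x hx => ?_⟩, ?_⟩
  · exact mem_filter.2 ⟨hS hx, fun e he h' => h e he (h'.trans
      (insert_subset (mem_union_right _ hx) subset_union_left))⟩
  rintro ⟨hYE, hSfree⟩ e he heYS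
  by_cases hx : ∃ x ∈ e, x ∈ S
  · obtain ⟨x, hxe, hxS⟩ := hx
    refine (mem_filter.1 (hSfree hxS)).2 e he fun y hy => ?_
    refine (mem_union.1 (heYS hy)).elim mem_insert_of_mem fun hyS => ?_
    rw [card_le_one.1 (hEN e he (heYS.trans hYS)) y (mem_inter.2 ⟨hy, hS hyS⟩) x
      (mem_inter.2 ⟨hxe, hS hxS⟩)]
    exact mem_insert_self _ _
  · push Not at hx
    exact hYE e he fun y hy => (mem_union.1 (heYS hy)).resolve_right (hx y hy)

theorem sum_indepSets_eq_sum_freeVerts {M : Type*} [AddCommMonoid M] (hN : N ⊆ U)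
    (hEN : ∀ f ∈ E, f ⊆ U → #(f ∩ N) ≤ 1) (F : Finset α → M) :
    ∑ W ∈ indepSets E U, F W =
      ∑ Y ∈ indepSets E (U \ N), ∑ S ∈ (freeVerts E N Y).powerset, F (Y ∪ S) := by
  have hdisj {Y S} (hY : Y ∈ indepSets E (U \ N)) (hS : S ∈ (freeVerts E N Y).powerset) :
      Y ⊆ U \ N ∧ S ⊆ N ∧ Disjoint Y N :=
    ⟨(mem_indepSets.1 hY).1, (mem_powerset.1 hS).trans (filter_subset _ _),
      disjoint_sdiff_self_left.mono_left (mem_indepSets.1 hY).1⟩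
  rw [sum_sigma']
  refine sum_bij' (fun W _ => ⟨W \ N, W ∩ N⟩) (fun YS _ => YS.1 ∪ YS.2) ?_ ?_ ?_ ?_ ?_
  · intro W hW
    rw [mem_sigma, mem_powerset, ← union_mem_indepSets_iff hN hEN
      (sdiff_subset_sdiff (mem_indepSets.1 hW).1 le_rfl) inter_subset_right, sdiff_union_inter]
    exact hW
  · rintro ⟨Y, S⟩ h
    obtain ⟨hY, hS⟩ := mem_sigma.1 h
    obtain ⟨hYU, hSN, -⟩ := hdisj hY hS
    exact (union_mem_indepSets_iff hN hEN hYU hSN).2 ⟨hY, mem_powerset.1 hS⟩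
  · exact fun W _ => sdiff_union_inter W N
  · rintro ⟨Y, S⟩ h
    obtain ⟨hY, hS⟩ := mem_sigma.1 h
    obtain ⟨-, hSN, hYN⟩ := hdisj hY hS
    simp only [union_sdiff_distrib, union_inter_distrib_right, hYN.sdiff_eq_left,
      sdiff_eq_empty_iff_subset.2 hSN, inter_eq_left.2 hSN, disjoint_iff_inter_eq_empty.1 hYN,
      union_empty, empty_union]
  · exact fun W _ => by rw [sdiff_union_inter]

end IndepSets

section PowersetCount

variable {α : Type*} [DecidableEq α] {R X : Finset α}

theorem card_filter_subset_powerset (h : R ⊆ X) :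
    (#{S ∈ X.powerset | R ⊆ S} : ℝ) = 2 ^ #X * (1 / 2) ^ #R := by
  have hIcc : {S ∈ X.powerset | R ⊆ S} = Icc R X := by
    ext S
    simp [and_comm]
  rw [hIcc, card_Icc_finset h, Nat.cast_pow, Nat.cast_ofNat,
    ← Nat.sub_add_cancel (card_le_card h), Nat.add_sub_cancel, pow_add, mul_assoc, ← mul_pow]
  norm_num

theorem card_filter_not_subset_powerset (h : R ⊆ X) :
    (#{S ∈ X.powerset | ¬ R ⊆ S} : ℝ) = 2 ^ #X * (1 - (1 / 2) ^ #R) := by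
  have hsplit := card_filter_add_card_filter_not (s := X.powerset) (R ⊆ ·)
  rw [card_powerset] at hsplit
  have hsplit' : (#{S ∈ X.powerset | R ⊆ S} : ℝ) + #{S ∈ X.powerset | ¬ R ⊆ S} = 2 ^ #X := by
    exact_mod_cast hsplit
  rw [card_filter_subset_powerset h] at hsplit'
  linarith

-- Avoiding `R i` is a down-closed event, so these events are positively correlated (Kleitman).
theorem two_pow_mul_prod_le_card_filter_not_subset {ι : Type*} (F : Finset ι)
    (R : ι → Finset α) (hR : ∀ i ∈ F, R i ⊆ X) :
    2 ^ #X * ∏ i ∈ F, (1 - (1 / 2 : ℝ) ^ #(R i)) ≤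
      #{S ∈ X.powerset | ∀ i ∈ F, ¬ R i ⊆ S} := by
  classical
  induction F using Finset.induction_on with
  | empty => simp
  | insert i F hi ih =>
    have hlower (P : Finset α → Prop) [DecidablePred P] (hP : ∀ ⦃S T⦄, T ⊆ S → P S → P T) :
        IsLowerSet (({S ∈ X.powerset | P S} : Finset (Finset α)) : Set (Finset α)) := by
      intro S T hTS hS
      simp only [coe_filter, Set.mem_ofPred_eq, mem_powerset] at hS ⊢
      exact ⟨hTS.trans hS.1, hP hTS hS.2⟩
    have hF := hlower (fun S => ∀ j ∈ F, ¬ R j ⊆ S) fun S T hTS h j hj hjT =>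
      h j hj (hjT.trans hTS)
    have hi' := hlower (fun S => ¬ R i ⊆ S) fun S T hTS h hT => h (hT.trans hTS)
    have hKleitman := hF.le_card_inter_finset' hi' (s := X)
      (fun t ht => mem_powerset.1 (mem_filter.1 ht).1)
      (fun t ht => mem_powerset.1 (mem_filter.1 ht).1)
    rw [← filter_and] at hKleitman
    have ih := ih fun j hj => hR j (mem_insert_of_mem hj)
    have hcard := card_filter_not_subset_powerset (hR i (mem_insert_self i F))
    have hfactor : (0 : ℝ) ≤ 1 - (1 / 2) ^ #(R i) :=
      sub_nonneg.2 (pow_le_one₀ (by norm_num) (by norm_num))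
    simp only [prod_insert hi, forall_mem_insert, and_comm (a := ¬ R i ⊆ _)]
    refine le_of_mul_le_mul_left ?_ (by positivity : (0 : ℝ) < 2 ^ #X)
    calc 2 ^ #X * (2 ^ #X * ((1 - (1 / 2) ^ #(R i)) * ∏ j ∈ F, (1 - (1 / 2 : ℝ) ^ #(R j))))
        = (2 ^ #X * ∏ j ∈ F, (1 - (1 / 2 : ℝ) ^ #(R j))) * (2 ^ #X * (1 - (1 / 2) ^ #(R i))) := by
          ring
      _ ≤ #{S ∈ X.powerset | ∀ j ∈ F, ¬ R j ⊆ S} * #{S ∈ X.powerset | ¬ R i ⊆ S} := by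
          rw [hcard]
          gcongr
      _ ≤ 2 ^ #X * #{S ∈ X.powerset | (∀ j ∈ F, ¬ R j ⊆ S) ∧ ¬ R i ⊆ S} := by
          exact_mod_cast hKleitman

end PowersetCount

section LocalInequality

variable {α : Type*} [DecidableEq α] {E : Finset (Finset α)} {U Y S X : Finset α} {v : α}
  {b : ℕ}

/-- The factor by which the number of link edges enters the local inequality, for link edges with
`b` vertices: a uniformly random set contains such an edge with probability `(1/2) ^ b` and avoids
it with probability `1 - (1/2) ^ b`. -/
noncomputable def linkConst (b : ℕ) : ℝ := -(2 ^ b * Real.log (1 - (1 / 2) ^ b))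

theorem linkConst_pos (hb : 1 ≤ b) : 0 < linkConst b := by
  have hlt : ((1 : ℝ) / 2) ^ b < 1 := pow_lt_one₀ (by norm_num) (by norm_num) (by lia)
  have hpos : (0 : ℝ) < (1 / 2) ^ b := by positivity
  have hlog : Real.log (1 - (1 / 2) ^ b) < 0 := Real.log_neg (by linarith) (by linarith)
  have h2 : (0 : ℝ) < 2 ^ b := by positivity
  rw [linkConst]
  nlinarith

theorem linkIn_eq_filter_of_subset (h : S ⊆ X) :
    linkIn E v S = {e ∈ linkIn E v X | e.erase v ⊆ S} := by
  ext e
  simp only [linkIn, mem_filter]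
  exact ⟨fun ⟨he, hv, hS⟩ => ⟨⟨he, hv, hS.trans h⟩, hS⟩, fun ⟨⟨he, hv, _⟩, hS⟩ => ⟨he, hv, hS⟩⟩

theorem linkIn_union_of_disjoint (hU : Y ∪ S ⊆ U) (hY : Disjoint Y (linkVerts E U v)) :
    linkIn E v (Y ∪ S) = linkIn E v S := by
  rw [linkIn_eq_filter_of_subset hU, linkIn_eq_filter_of_subset (subset_union_right.trans hU)]
  refine filter_congr fun e he => ⟨fun h => ?_, fun h => h.trans subset_union_right⟩
  have hlink : e.erase v ⊆ linkVerts E U v := subset_biUnion_of_mem (fun e => e.erase v) he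
  exact (hY.symm.mono_left hlink).left_le_of_le_sup_left h

theorem card_erase_of_mem_linkIn (hE : (E : Set (Finset α)).Sized (b + 1)) {e : Finset α}
    (he : e ∈ linkIn E v X) : #(e.erase v) = b := by
  obtain ⟨heE, hve, -⟩ := mem_linkIn.1 he
  rw [card_erase_of_mem hve, hE heE, Nat.add_sub_cancel]

theorem sum_powerset_card_linkIn (hE : (E : Set (Finset α)).Sized (b + 1)) :
    ∑ S ∈ X.powerset, (#(linkIn E v S) : ℝ) = #(linkIn E v X) * (2 ^ #X * (1 / 2) ^ b) := by
  have hcard : ∀ S ∈ X.powerset, (#(linkIn E v S) : ℝ) =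
      ∑ e ∈ linkIn E v X, if e.erase v ⊆ S then (1 : ℝ) else 0 := fun S hS => by
    rw [linkIn_eq_filter_of_subset (mem_powerset.1 hS), natCast_card_filter]
  rw [sum_congr rfl hcard, sum_comm, ← nsmul_eq_mul]
  refine sum_eq_card_nsmul fun e he => ?_
  rw [← natCast_card_filter, card_filter_subset_powerset (mem_linkIn.1 he).2.2,
    card_erase_of_mem_linkIn hE he]

theorem two_pow_mul_pow_le_card_linkIn_eq_empty (hE : (E : Set (Finset α)).Sized (b + 1)) :
    2 ^ #X * (1 - (1 / 2 : ℝ) ^ b) ^ #(linkIn E v X) ≤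
      #{S ∈ X.powerset | linkIn E v S = ∅} := by
  have hfilter : {S ∈ X.powerset | linkIn E v S = ∅} =
      {S ∈ X.powerset | ∀ e ∈ linkIn E v X, ¬ e.erase v ⊆ S} :=
    filter_congr fun S hS => by
      rw [linkIn_eq_filter_of_subset (mem_powerset.1 hS), filter_eq_empty_iff]
  rw [hfilter]
  refine le_of_eq_of_le ?_ (two_pow_mul_prod_le_card_filter_not_subset (linkIn E v X)
    (fun e => e.erase v) fun e he => (mem_linkIn.1 he).2.2)
  rw [prod_congr rfl fun e he => by rw [card_erase_of_mem_linkIn hE he], prod_const]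

-- Writing `M` for the number of link edges inside `X` and `q = 1 - (1/2) ^ b`, the bound `q ^ M`
-- is convex in `M`; it is replaced by its tangent line at `q ^ M = exp (-L)`.
theorem le_card_linkIn_eq_empty (hb : 1 ≤ b) (hE : (E : Set (Finset α)).Sized (b + 1)) (L : ℝ) :
    Real.exp (-L) * ((1 + L) * 2 ^ #X - linkConst b * ∑ S ∈ X.powerset, (#(linkIn E v S) : ℝ)) ≤
      #{S ∈ X.powerset | linkIn E v S = ∅} := by
  refine le_trans ?_ (two_pow_mul_pow_le_card_linkIn_eq_empty hE)
  rw [sum_powerset_card_linkIn hE, linkConst]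
  set q : ℝ := 1 - (1 / 2) ^ b
  set M := #(linkIn E v X)
  have hq : 0 < q := sub_pos.2 (pow_lt_one₀ (by norm_num) (by norm_num) (by lia))
  have hpow : q ^ M = Real.exp (-L) * Real.exp (L + M * Real.log q) := by
    rw [← Real.exp_add, neg_add_cancel_left, Real.exp_nat_mul, Real.exp_log hq]
  have hcancel : (2 : ℝ) ^ b * (1 / 2) ^ b = 1 := by rw [← mul_pow]; norm_num
  calc _ = 2 ^ #X * (Real.exp (-L) *
        (M * Real.log q * ((2 : ℝ) ^ b * (1 / 2) ^ b) + L + 1)) := by ring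
    _ ≤ 2 ^ #X * (Real.exp (-L) * Real.exp (L + M * Real.log q)) := by
        rw [hcancel, mul_one, add_comm (M * Real.log q) L]
        gcongr
        exact Real.add_one_le_exp _
    _ = _ := by rw [hpow]

/-- The probability that a uniformly random independent subset of `U` stays independent when `v`
is added to it. -/
noncomputable def extensionProb (E : Finset (Finset α)) (U : Finset α) (v : α) : ℝ :=
  𝔼 W ∈ indepSets E U, if linkIn E v W = ∅ then 1 else 0

/-- The expected number of link edges of `v` inside a uniformly random independent subset
of `U`. -/
noncomputable def meanLink (E : Finset (Finset α)) (U : Finset α) (v : α) : ℝ :=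
  𝔼 W ∈ indepSets E U, (#(linkIn E v W) : ℝ)

/-- The probability that a uniformly random independent subset of `U` contains `v`. -/
noncomputable def occupancy (E : Finset (Finset α)) (U : Finset α) (v : α) : ℝ :=
  𝔼 W ∈ indepSets E U, if v ∈ W then 1 else 0

theorem extensionProb_nonneg : 0 ≤ extensionProb E U v :=
  expect_nonneg fun _ _ => by positivity

theorem le_extensionProb (hb : 1 ≤ b) (hE : (E : Set (Finset α)).Sized (b + 1))
    (hv : LocallySparse E U v) (L : ℝ) :
    Real.exp (-L) * (1 + L - linkConst b * meanLink E U v) ≤ extensionProb E U v := by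
  have hempty : ∅ ∉ E := fun h => by simpa using hE h
  have hpos : (0 : ℝ) < #(indepSets E U) := by exact_mod_cast (indepSets_nonempty hempty).card_pos
  have hN : linkVerts E U v ⊆ U := linkVerts_subset
  suffices ∑ W ∈ indepSets E U, Real.exp (-L) * (1 + L - linkConst b * #(linkIn E v W)) ≤
      ∑ W ∈ indepSets E U, if linkIn E v W = ∅ then (1 : ℝ) else 0 by
    rw [extensionProb, meanLink, expect_eq_sum_div_card, expect_eq_sum_div_card, le_div_iff₀ hpos]
    rw [← mul_sum, sum_sub_distrib, sum_const, ← mul_sum, nsmul_eq_mul] at this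
    refine le_of_eq_of_le ?_ this
    field_simp
  rw [sum_indepSets_eq_sum_freeVerts hN hv, sum_indepSets_eq_sum_freeVerts hN hv]
  refine sum_le_sum fun Y hY => ?_
  have hYU := (mem_indepSets.1 hY).1
  set X := freeVerts E (linkVerts E U v) Y
  have hXU : X ⊆ U := (filter_subset _ _).trans hN
  have hlink (F : Finset (Finset α) → ℝ) :
      ∑ S ∈ X.powerset, F (linkIn E v (Y ∪ S)) = ∑ S ∈ X.powerset, F (linkIn E v S) :=
    sum_congr rfl fun S hS => by
      rw [linkIn_union_of_disjoint (union_subset (hYU.trans sdiff_subset)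
        ((mem_powerset.1 hS).trans hXU)) (disjoint_sdiff_self_left.mono_left hYU)]
  calc ∑ S ∈ X.powerset, Real.exp (-L) * (1 + L - linkConst b * #(linkIn E v (Y ∪ S)))
      = Real.exp (-L) *
          ((1 + L) * 2 ^ #X - linkConst b * ∑ S ∈ X.powerset, (#(linkIn E v S) : ℝ)) := by
        rw [hlink fun l => Real.exp (-L) * (1 + L - linkConst b * #l), ← mul_sum,
          sum_sub_distrib, sum_const, card_powerset, ← mul_sum, nsmul_eq_mul, Nat.cast_pow,
          Nat.cast_ofNat, mul_comm (1 + L)]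
    _ ≤ #{S ∈ X.powerset | linkIn E v S = ∅} := le_card_linkIn_eq_empty hb hE L
    _ = ∑ S ∈ X.powerset, if linkIn E v (Y ∪ S) = ∅ then (1 : ℝ) else 0 := by
        rw [hlink fun l => if l = ∅ then 1 else 0, natCast_card_filter]

theorem extensionProb_le_two_mul_occupancy (hE : ∅ ∉ E) (hv : v ∉ U) :
    extensionProb E U v ≤ 2 * occupancy E (insert v U) v := by
  have hsplit := card_filter_add_card_filter_not (s := indepSets E (insert v U)) (v ∈ ·)
  rw [filter_notMem_indepSets_insert hv, card_filter_mem_indepSets_insert hv] at hsplit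
  have hle : #{W ∈ indepSets E U | linkIn E v W = ∅} ≤ #(indepSets E U) :=
    card_le_card (filter_subset _ _)
  have hpos : 0 < #(indepSets E U) := (indepSets_nonempty hE).card_pos
  rw [extensionProb, occupancy, expect_eq_sum_div_card, expect_eq_sum_div_card,
    ← natCast_card_filter, ← natCast_card_filter, card_filter_mem_indepSets_insert hv, ← hsplit,
    Nat.cast_add, mul_div_assoc', div_le_div_iff₀ (by positivity) (by positivity)]
  have hle' : (#{W ∈ indepSets E U | linkIn E v W = ∅} : ℝ) ≤ #(indepSets E U) := by
    exact_mod_cast hle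
  nlinarith

theorem sum_occupancy_le (hE : ∅ ∉ E) {a : ℕ} (ha : ∀ W ∈ indepSets E U, #W ≤ a) :
    ∑ v ∈ U, occupancy E U v ≤ a := by
  simp only [occupancy, ← expect_sum_comm]
  refine expect_le (indepSets_nonempty hE) fun W hW => ?_
  rw [sum_ite_mem, sum_const, nsmul_one, inter_eq_right.2 (mem_indepSets.1 hW).1]
  exact_mod_cast ha W hW

end LocalInequality

section RandomSubset

variable {α ι : Type*} {p : ℝ} {V : Finset α}

/-- The expectation of `F` at a random subset of `V` that contains each element of `V`
independently with probability `p`. -/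
noncomputable def bernoulliExpect (p : ℝ) (V : Finset α) (F : Finset α → ℝ) : ℝ :=
  ∑ U ∈ V.powerset, p ^ #U * (1 - p) ^ (#V - #U) * F U

/-- The probability that a random subset of `V`, containing each element of `V` independently with
probability `p`, satisfies `P`. -/
noncomputable def bernoulliProb (p : ℝ) (V : Finset α) (P : Finset α → Prop) [DecidablePred P] :
    ℝ :=
  bernoulliExpect p V fun U => if P U then 1 else 0

theorem bernoulliExpect_const (c : ℝ) : bernoulliExpect p V (fun _ => c) = c := by
  rw [bernoulliExpect, ← sum_mul, sum_pow_mul_eq_add_pow, add_sub_cancel, one_pow, one_mul]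

theorem bernoulliExpect_const_mul (c : ℝ) (F : Finset α → ℝ) :
    bernoulliExpect p V (fun U => c * F U) = c * bernoulliExpect p V F := by
  simp only [bernoulliExpect, mul_sum, mul_left_comm c]

theorem bernoulliExpect_sub (F G : Finset α → ℝ) :
    bernoulliExpect p V (fun U => F U - G U) =
      bernoulliExpect p V F - bernoulliExpect p V G := by
  simp only [bernoulliExpect, mul_sub, sum_sub_distrib]

theorem bernoulliExpect_sum (s : Finset ι) (F : ι → Finset α → ℝ) :
    bernoulliExpect p V (fun U => ∑ i ∈ s, F i U) = ∑ i ∈ s, bernoulliExpect p V (F i) := by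
  simp only [bernoulliExpect, mul_sum]
  exact sum_comm

theorem bernoulliExpect_mono (hp : 0 ≤ p) (hp1 : p ≤ 1) {F G : Finset α → ℝ}
    (h : ∀ U ⊆ V, F U ≤ G U) : bernoulliExpect p V F ≤ bernoulliExpect p V G :=
  sum_le_sum fun U hU => mul_le_mul_of_nonneg_left (h U (mem_powerset.1 hU))
    (mul_nonneg (pow_nonneg hp _) (pow_nonneg (sub_nonneg.2 hp1) _))

theorem bernoulliProb_mono (hp : 0 ≤ p) (hp1 : p ≤ 1) {P Q : Finset α → Prop} [DecidablePred P]
    [DecidablePred Q] (h : ∀ U ⊆ V, P U → Q U) : bernoulliProb p V P ≤ bernoulliProb p V Q :=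
  bernoulliExpect_mono hp hp1 fun U hU => by
    split_ifs with hP hQ
    exacts [le_rfl, absurd (h U hU hP) hQ, zero_le_one, le_rfl]

variable [DecidableEq α]

theorem bernoulliProb_superset {S : Finset α} (hS : S ⊆ V) :
    bernoulliProb p V (S ⊆ ·) = p ^ #S := by
  have hcard : #(V \ S) + #S = #V := card_sdiff_add_card_eq_card hS
  simp only [bernoulliProb, bernoulliExpect, mul_ite, mul_one, mul_zero, ← sum_filter]
  refine Eq.trans ?_ (bernoulliExpect_const (p := p) (V := V \ S) (p ^ #S))
  refine sum_bij' (fun U _ => U \ S) (fun T _ => S ∪ T) ?_ ?_ ?_ ?_ ?_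
  · intro U hU
    exact mem_powerset.2 (sdiff_subset_sdiff (mem_powerset.1 (mem_filter.1 hU).1) le_rfl)
  · intro T hT
    exact mem_filter.2 ⟨mem_powerset.2 (union_subset hS ((mem_powerset.1 hT).trans sdiff_subset)),
      subset_union_left⟩
  · exact fun U hU => union_sdiff_of_subset (mem_filter.1 hU).2
  · exact fun T hT => union_sdiff_cancel_left
      (disjoint_sdiff.mono_right (mem_powerset.1 hT))
  · intro U hU
    have hUS : #(U \ S) + #S = #U := card_sdiff_add_card_eq_card (mem_filter.1 hU).2
    rw [mul_right_comm, ← pow_add, hUS, show #V - #U = #(V \ S) - #(U \ S) by lia]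

theorem bernoulliProb_exists_subset_le (hp : 0 ≤ p) (hp1 : p ≤ 1) (s : Finset ι)
    (S : ι → Finset α) (hS : ∀ i ∈ s, S i ⊆ V) :
    bernoulliProb p V (fun U => ∃ i ∈ s, S i ⊆ U) ≤ ∑ i ∈ s, p ^ #(S i) := by
  rw [← sum_congr rfl fun i hi => bernoulliProb_superset (p := p) (hS i hi)]
  simp only [bernoulliProb, ← bernoulliExpect_sum]
  refine bernoulliExpect_mono hp hp1 fun U _ => ?_
  split_ifs with h
  · obtain ⟨i, hi, hiU⟩ := h
    exact (if_pos hiU).ge.trans (single_le_sum (f := fun j => if S j ⊆ U then (1 : ℝ) else 0)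
      (fun j _ => by positivity) hi)
  · exact sum_nonneg fun i _ => by positivity

-- A pair `(U, v)` with `v ∉ U` has the weight of `(insert v U, v)` multiplied by `(1 - p) / p`.
theorem bernoulliExpect_exchange (g : Finset α → α → ℝ) :
    p * bernoulliExpect p V (fun U => ∑ v ∈ V \ U, g (insert v U) v) =
      (1 - p) * bernoulliExpect p V fun U => ∑ v ∈ U, g U v := by
  simp only [bernoulliExpect, mul_sum]
  rw [sum_sigma', sum_sigma']
  refine sum_bij' (fun x _ => ⟨insert x.2 x.1, x.2⟩) (fun x _ => ⟨x.1.erase x.2, x.2⟩)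
    ?_ ?_ ?_ ?_ ?_ <;> rintro ⟨U, v⟩ h
  · simp only [mem_sigma, mem_powerset, mem_sdiff] at h ⊢
    exact ⟨insert_subset h.2.1 h.1, mem_insert_self _ _⟩
  · simp only [mem_sigma, mem_powerset, mem_sdiff] at h ⊢
    exact ⟨(erase_subset _ _).trans h.1, h.1 h.2, notMem_erase _ _⟩
  · simp only [mem_sigma, mem_sdiff] at h
    simp only [erase_insert h.2.2]
  · simp only [insert_erase (mem_sigma.1 h).2]
  · simp only [mem_sigma, mem_powerset, mem_sdiff] at h
    have hcard := card_insert_of_notMem h.2.2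
    have hle := card_le_card (insert_subset h.2.1 h.1)
    rw [hcard, show #V - #U = #V - (#U + 1) + 1 by lia]
    ring

theorem bernoulliExpect_sum_extensionProb_le {E : Finset (Finset α)} (hE : ∅ ∉ E) (hp : 0 ≤ p)
    (hp1 : p ≤ 1) {a : ℕ} (ha : ∀ W ∈ indepSets E V, #W ≤ a) :
    p * bernoulliExpect p V (fun U => ∑ v ∈ V \ U, extensionProb E U v) ≤ 2 * a := by
  have hocc : ∀ U ⊆ V, ∑ v ∈ U, 2 * occupancy E U v ≤ 2 * a := fun U hU => by
    rw [← mul_sum]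
    gcongr
    exact sum_occupancy_le hE fun W hW => ha W <|
      mem_indepSets.2 ⟨(mem_indepSets.1 hW).1.trans hU, (mem_indepSets.1 hW).2⟩
  calc p * bernoulliExpect p V (fun U => ∑ v ∈ V \ U, extensionProb E U v)
      ≤ p * bernoulliExpect p V (fun U => ∑ v ∈ V \ U, 2 * occupancy E (insert v U) v) := by
        refine mul_le_mul_of_nonneg_left (bernoulliExpect_mono hp hp1 fun U _ => ?_) hp
        exact sum_le_sum fun v hv => extensionProb_le_two_mul_occupancy hE (mem_sdiff.1 hv).2
    _ = (1 - p) * bernoulliExpect p V (fun U => ∑ v ∈ U, 2 * occupancy E U v) :=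
        bernoulliExpect_exchange fun U v => 2 * occupancy E U v
    _ ≤ 1 * bernoulliExpect p V (fun _ => 2 * a) :=
        mul_le_mul (by linarith) (bernoulliExpect_mono hp hp1 hocc)
          (sum_nonneg fun U _ => mul_nonneg (by have := sub_nonneg.2 hp1; positivity)
            (sum_nonneg fun v _ => mul_nonneg two_pos.le (expect_nonneg fun _ _ => by positivity)))
          zero_le_one
    _ = 2 * a := by rw [bernoulliExpect_const, one_mul]

end RandomSubset

section LocalSparsity

variable {α : Type*} [DecidableEq α] {E : Finset (Finset α)} {U V A B : Finset α} {v : α}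
  {p D : ℝ} {b d : ℕ}

/-- The codegree of `R`: the number of members of `E` that contain `R`. -/
def codegree (E : Finset (Finset α)) (R : Finset α) : ℕ := #{e ∈ E | R ⊆ e}

theorem codegree_le (hE : (E : Set (Finset α)).Sized (b + 1)) (hEV : ∀ e ∈ E, e ⊆ V)
    (hd : ∀ R, #R = b → codegree E R ≤ d) (hB : #B ≤ b) :
    codegree E B ≤ #V ^ (b - #B) * d := by
  induction hi : b - #B generalizing B with
  | zero => simpa using hd B (by lia)
  | succ i ih =>
    have hcover : {e ∈ E | B ⊆ e} ⊆ (V \ B).biUnion fun x => {e ∈ E | insert x B ⊆ e} := by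
      intro e he
      obtain ⟨heE, hBe⟩ := mem_filter.1 he
      obtain ⟨x, hxe, hxB⟩ := exists_mem_notMem_of_card_lt_card (s := B) (t := e)
        (by rw [hE heE]; lia)
      exact mem_biUnion.2 ⟨x, mem_sdiff.2 ⟨hEV e heE hxe, hxB⟩,
        mem_filter.2 ⟨heE, insert_subset hxe hBe⟩⟩
    refine (card_le_card hcover).trans
      ((card_biUnion_le_card_mul _ _ (#V ^ i * d) fun x hx => ?_).trans ?_)
    · have hcard := card_insert_of_notMem (mem_sdiff.1 hx).2
      exact ih (by lia) (by lia)
    · rw [pow_succ, mul_right_comm, mul_comm]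
      exact Nat.mul_le_mul_left _ (card_le_card sdiff_subset)

theorem sum_pow_card_sdiff_of_inter_eq_le (hE : (E : Set (Finset α)).Sized (b + 1))
    (hEV : ∀ e ∈ E, e ⊆ V) (hd : ∀ R, #R = b → codegree E R ≤ d) (hp : 0 ≤ p) (hB : #B ≤ b) :
    ∑ f ∈ E with f ∩ A = B, p ^ #(f \ A) ≤ p * d * (p * #V) ^ (b - #B) := by
  have hpow : ∀ f ∈ E.filter (· ∩ A = B), p ^ #(f \ A) = p ^ (b - #B + 1) := fun f hf => by
    obtain ⟨hfE, hfB⟩ := mem_filter.1 hf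
    have hcard := card_sdiff_add_card_inter f A
    rw [hfB, hE hfE] at hcard
    congr 1
    lia
  have hcard : #(E.filter (· ∩ A = B)) ≤ #V ^ (b - #B) * d :=
    (card_le_card fun f hf => mem_filter.2 ⟨(mem_filter.1 hf).1,
      (mem_filter.1 hf).2 ▸ inter_subset_left⟩).trans (codegree_le hE hEV hd hB)
  rw [sum_congr rfl hpow, sum_const, nsmul_eq_mul]
  calc (#(E.filter (· ∩ A = B)) : ℝ) * p ^ (b - #B + 1)
      ≤ ((#V ^ (b - #B) * d : ℕ) : ℝ) * p ^ (b - #B + 1) := by gcongr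
    _ = p * d * (p * #V) ^ (b - #B) := by push_cast; ring

theorem sum_pow_card_sdiff_le (hE : (E : Set (Finset α)).Sized (b + 1)) (hEV : ∀ e ∈ E, e ⊆ V)
    (hd : ∀ R, #R = b → codegree E R ≤ d) (hp : 0 ≤ p) (hm : 1 ≤ p * #V) (A : Finset α) (j : ℕ) :
    ∑ f ∈ E with j ≤ #(f ∩ A) ∧ ¬ f ⊆ A, p ^ #(f \ A) ≤
      2 ^ #A * (p * d * (p * #V) ^ (b - j)) := by
  rw [← sum_fiberwise_of_maps_to (t := A.powerset) (g := (· ∩ A))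
    (fun f _ => mem_powerset.2 inter_subset_right)]
  refine (sum_le_card_nsmul _ _ (p * d * (p * #V) ^ (b - j)) fun B hB => ?_).trans_eq
    (by rw [card_powerset, nsmul_eq_mul, Nat.cast_pow, Nat.cast_ofNat])
  rw [filter_filter]
  by_cases hjB : j ≤ #B ∧ #B ≤ b
  · calc ∑ f ∈ E with (j ≤ #(f ∩ A) ∧ ¬ f ⊆ A) ∧ f ∩ A = B, p ^ #(f \ A)
        ≤ ∑ f ∈ E with f ∩ A = B, p ^ #(f \ A) :=
          sum_le_sum_of_subset_of_nonneg (monotone_filter_right _ fun _ _ h => h.2)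
            fun _ _ _ => pow_nonneg hp _
      _ ≤ p * d * (p * #V) ^ (b - #B) := sum_pow_card_sdiff_of_inter_eq_le hE hEV hd hp hjB.2
      _ ≤ p * d * (p * #V) ^ (b - j) := by
          gcongr
          lia
  · rw [filter_eq_empty_iff.2, sum_empty]
    · positivity
    · rintro f hf ⟨⟨hj, hfA⟩, rfl⟩
      have hlt := card_lt_card (inter_subset_left.ssubset_of_ne fun h => hfA (inter_eq_left.1 h))
      rw [hE hf] at hlt
      exact hjB ⟨hj, Nat.le_of_lt_succ hlt⟩

theorem sum_star_pow_card_sdiff_le (hE : (E : Set (Finset α)).Sized (b + 1))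
    (hEV : ∀ e ∈ E, e ⊆ V) (hd : ∀ R, #R = b → codegree E R ≤ d) (hp : 0 ≤ p)
    (hm : 1 ≤ p * #V) (hD1 : 1 ≤ D) (hD : p * d * (p * #V) ^ (b - 1) ≤ D) (hv : v ∈ A) :
    ∑ e ∈ E with v ∈ e, p ^ #(e \ A) ≤ 2 ^ (#A + 1) * D := by
  have hinside : ∑ e ∈ E.filter (v ∈ ·) with e ⊆ A, p ^ #(e \ A) ≤ 2 ^ #A := by
    rw [sum_congr rfl fun e he => by rw [sdiff_eq_empty_iff_subset.2 (mem_filter.1 he).2],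
      sum_const, card_empty, pow_zero, nsmul_one]
    exact_mod_cast (card_le_card fun e he => mem_powerset.2 (mem_filter.1 he).2).trans_eq
      (card_powerset A)
  have houtside : ∑ e ∈ E.filter (v ∈ ·) with ¬ e ⊆ A, p ^ #(e \ A) ≤ 2 ^ #A * D := by
    refine (sum_le_sum_of_subset_of_nonneg (fun e he => ?_) fun _ _ _ => pow_nonneg hp _).trans
      ((sum_pow_card_sdiff_le hE hEV hd hp hm A 1).trans (by gcongr))
    rw [filter_filter, mem_filter] at he
    exact mem_filter.2 ⟨he.1, card_pos.2 ⟨v, mem_inter.2 ⟨he.2.1, hv⟩⟩, he.2.2⟩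
  rw [← sum_filter_add_sum_filter_not _ (· ⊆ A), pow_succ]
  have hpow : (2 : ℝ) ^ #A ≤ 2 ^ #A * D := le_mul_of_one_le_right (by positivity) hD1
  linarith

/-- The edges avoiding `v` that, together with the edges `e₁` and `e₂` through `v`, witness that
the link of `v` is not locally sparse. Edges contained in `e₁ ∪ e₂` are left out: they are also
witnesses for one of the pairs `(e₁, e₁)` and `(e₂, e₂)`. -/
def crossing (E : Finset (Finset α)) (v : α) (e₁ e₂ : Finset α) : Finset (Finset α) :=
  {f ∈ E | v ∉ f ∧ 2 ≤ #(f ∩ (e₁ ∪ e₂)) ∧ ¬ f ⊆ e₁ ∪ e₂}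

theorem mem_crossing_self {e f : Finset α} (hE : (E : Set (Finset α)).Sized (b + 1)) (he : e ∈ E)
    (hf : f ∈ E) (hve : v ∈ e) (hvf : v ∉ f) (hef : 2 ≤ #(f ∩ e)) : f ∈ crossing E v e e := by
  rw [crossing, union_self, mem_filter]
  exact ⟨hf, hvf, hef, fun hsub =>
    hvf (eq_of_subset_of_card_le hsub (by rw [hE he, hE hf]) ▸ hve)⟩

theorem exists_crossing_of_not_locallySparse (hb : 2 ≤ b)
    (hE : (E : Set (Finset α)).Sized (b + 1)) (hv : v ∉ U) (hU : ¬ LocallySparse E U v) :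
    ∃ e₁ ∈ linkIn E v U, ∃ e₂ ∈ linkIn E v U, ∃ f ∈ crossing E v e₁ e₂, f ⊆ U := by
  simp only [LocallySparse, not_forall, not_le, one_lt_card] at hU
  obtain ⟨f, hf, hfU, x, hx, y, hy, hxy⟩ := hU
  obtain ⟨hxf, hxN⟩ := mem_inter.1 hx
  obtain ⟨hyf, hyN⟩ := mem_inter.1 hy
  obtain ⟨e₁, he₁, hxe⟩ := mem_biUnion.1 hxN
  obtain ⟨e₂, he₂, hye⟩ := mem_biUnion.1 hyN
  have hvf : v ∉ f := fun h => hv (hfU h)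
  by_cases hsub : f ⊆ e₁ ∪ e₂
  · have hself {e} (he : e ∈ linkIn E v U) (h : 2 ≤ #(f ∩ e)) : f ∈ crossing E v e e :=
      mem_crossing_self hE (mem_linkIn.1 he).1 hf (mem_linkIn.1 he).2.1 hvf h
    have hcard := card_union_le (f ∩ e₁) (f ∩ e₂)
    rw [← inter_union_distrib_left, inter_eq_left.2 hsub, hE hf] at hcard
    by_cases h₁ : 2 ≤ #(f ∩ e₁)
    · exact ⟨e₁, he₁, e₁, he₁, f, hself he₁ h₁, hfU⟩
    · exact ⟨e₂, he₂, e₂, he₂, f, hself he₂ (by lia), hfU⟩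
  · refine ⟨e₁, he₁, e₂, he₂, f, mem_filter.2 ⟨hf, hvf, ?_, hsub⟩, hfU⟩
    exact one_lt_card.2 ⟨x, mem_inter.2 ⟨hxf, mem_union_left _ (mem_of_mem_erase hxe)⟩,
      y, mem_inter.2 ⟨hyf, mem_union_right _ (mem_of_mem_erase hye)⟩, hxy⟩

theorem card_erase_union_union {e₁ e₂ f : Finset α} (h₁ : v ∈ e₁) (hf : v ∉ f) :
    #((e₁ ∪ e₂ ∪ f).erase v) = #(e₁ \ {v}) + #(e₂ \ e₁) + #(f \ (e₁ ∪ e₂)) := by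
  have hparts : (e₁ ∪ e₂ ∪ f).erase v = (e₁ \ {v} ∪ e₂ \ e₁) ∪ f \ (e₁ ∪ e₂) := by
    ext x
    grind
  rw [hparts, card_union_of_disjoint, card_union_of_disjoint]
  · exact disjoint_sdiff.mono_left sdiff_subset
  · exact disjoint_sdiff.mono_left (union_subset_union sdiff_subset sdiff_subset)

theorem bernoulliProb_not_locallySparse_le (hb : 2 ≤ b)
    (hE : (E : Set (Finset α)).Sized (b + 1)) (hEV : ∀ e ∈ E, e ⊆ V) (hp : 0 ≤ p) (hp1 : p ≤ 1) :
    bernoulliProb p V (fun U => v ∉ U ∧ ¬ LocallySparse E U v) ≤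
      ∑ e₁ ∈ E with v ∈ e₁, p ^ #(e₁ \ {v}) * ∑ e₂ ∈ E with v ∈ e₂, p ^ #(e₂ \ e₁) *
        ∑ f ∈ crossing E v e₁ e₂, p ^ #(f \ (e₁ ∪ e₂)) := by
  set s := (E.filter (v ∈ ·)).sigma fun e₁ => (E.filter (v ∈ ·)).sigma fun e₂ => crossing E v e₁ e₂
  refine (bernoulliProb_mono hp hp1 fun U _ hU => ?_).trans
    ((bernoulliProb_exists_subset_le hp hp1 s (fun t => (t.1 ∪ t.2.1 ∪ t.2.2).erase v)
      fun t ht => ?_).trans_eq ?_)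
  · obtain ⟨e₁, he₁, e₂, he₂, f, hf, hfU⟩ := exists_crossing_of_not_locallySparse hb hE hU.1 hU.2
    obtain ⟨he₁E, hve₁, he₁U⟩ := mem_linkIn.1 he₁
    obtain ⟨he₂E, hve₂, he₂U⟩ := mem_linkIn.1 he₂
    refine ⟨⟨e₁, e₂, f⟩, ?_, ?_⟩
    · simp only [s, mem_sigma, mem_filter]
      exact ⟨⟨he₁E, hve₁⟩, ⟨he₂E, hve₂⟩, hf⟩
    · rw [erase_union_distrib, erase_union_distrib]
      exact union_subset (union_subset he₁U he₂U) ((erase_subset _ _).trans hfU)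
  · simp only [s, crossing, mem_sigma, mem_filter] at ht
    exact (erase_subset _ _).trans (union_subset (union_subset (hEV _ ht.1.1) (hEV _ ht.2.1.1))
      (hEV _ ht.2.2.1))
  · simp only [s, sum_sigma, mul_sum]
    refine sum_congr rfl fun e₁ he₁ => sum_congr rfl fun e₂ _ => sum_congr rfl fun f hf => ?_
    rw [card_erase_union_union (mem_filter.1 he₁).2 (mem_filter.1 hf).2.1, pow_add, pow_add,
      mul_assoc]

theorem sum_crossing_pow_card_sdiff_le (hb : 2 ≤ b) (hE : (E : Set (Finset α)).Sized (b + 1))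
    (hEV : ∀ e ∈ E, e ⊆ V) (hd : ∀ R, #R = b → codegree E R ≤ d) (hp : 0 ≤ p)
    (hm : 1 ≤ p * #V) (hD : p * d * (p * #V) ^ (b - 1) ≤ D) {e₁ e₂ : Finset α} (he₁ : e₁ ∈ E)
    (he₂ : e₂ ∈ E) :
    ∑ f ∈ crossing E v e₁ e₂, p ^ #(f \ (e₁ ∪ e₂)) ≤ 2 ^ (2 * b + 2) * (D / (p * #V)) := by
  have hcard : #(e₁ ∪ e₂) ≤ 2 * b + 2 := by
    have h := card_union_le e₁ e₂
    rw [hE he₁, hE he₂] at h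
    lia
  calc ∑ f ∈ crossing E v e₁ e₂, p ^ #(f \ (e₁ ∪ e₂))
      ≤ ∑ f ∈ E with 2 ≤ #(f ∩ (e₁ ∪ e₂)) ∧ ¬ f ⊆ e₁ ∪ e₂, p ^ #(f \ (e₁ ∪ e₂)) :=
        sum_le_sum_of_subset_of_nonneg (monotone_filter_right _ fun _ _ h => h.2)
          fun _ _ _ => pow_nonneg hp _
    _ ≤ 2 ^ #(e₁ ∪ e₂) * (p * d * (p * #V) ^ (b - 2)) :=
        sum_pow_card_sdiff_le hE hEV hd hp hm _ 2
    _ ≤ 2 ^ (2 * b + 2) * (D / (p * #V)) := by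
        gcongr
        · exact one_le_two
        · rwa [le_div_iff₀ (by linarith), mul_assoc, ← pow_succ, show b - 2 + 1 = b - 1 by lia]

theorem bernoulliProb_not_locallySparse_le_half (hb : 2 ≤ b)
    (hE : (E : Set (Finset α)).Sized (b + 1)) (hEV : ∀ e ∈ E, e ⊆ V)
    (hd : ∀ R, #R = b → codegree E R ≤ d) (hp : 0 ≤ p) (hp1 : p ≤ 1) (hD1 : 1 ≤ D)
    (hD : p * d * (p * #V) ^ (b - 1) ≤ D)
    (hDm : 2 ^ (3 * b + 7) * D ^ 3 ≤ p * #V) :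
    bernoulliProb p V (fun U => v ∉ U ∧ ¬ LocallySparse E U v) ≤ 1 / 2 := by
  have hm : 1 ≤ p * #V :=
    (one_le_mul_of_one_le_of_one_le (one_le_pow₀ one_le_two) (one_le_pow₀ hD1)).trans hDm
  have hm0 : 0 < p * #V := zero_lt_one.trans_le hm
  have hstar₂ : ∀ e₁ ∈ E.filter (v ∈ ·), ∑ e₂ ∈ E with v ∈ e₂, p ^ #(e₂ \ e₁) ≤ 2 ^ (b + 2) * D :=
    fun e₁ he₁ => by
      have h := sum_star_pow_card_sdiff_le hE hEV hd hp hm hD1 hD (mem_filter.1 he₁).2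
      rwa [hE (mem_filter.1 he₁).1] at h
  have hstar₁ : ∑ e₁ ∈ E with v ∈ e₁, p ^ #(e₁ \ {v}) ≤ 2 ^ 2 * D :=
    sum_star_pow_card_sdiff_le hE hEV hd hp hm hD1 hD (mem_singleton_self v)
  calc bernoulliProb p V (fun U => v ∉ U ∧ ¬ LocallySparse E U v)
      ≤ _ := bernoulliProb_not_locallySparse_le hb hE hEV hp hp1
    _ ≤ ∑ e₁ ∈ E with v ∈ e₁, p ^ #(e₁ \ {v}) * ∑ e₂ ∈ E with v ∈ e₂, p ^ #(e₂ \ e₁) *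
        (2 ^ (2 * b + 2) * (D / (p * #V))) := by
        gcongr with e₁ he₁ e₂ he₂
        exact sum_crossing_pow_card_sdiff_le hb hE hEV hd hp hm hD (mem_filter.1 he₁).1
          (mem_filter.1 he₂).1
    _ ≤ ∑ e₁ ∈ E with v ∈ e₁, p ^ #(e₁ \ {v}) *
        ((2 ^ (b + 2) * D) * (2 ^ (2 * b + 2) * (D / (p * #V)))) := by
        gcongr with e₁ he₁
        rw [← sum_mul]
        gcongr
        exact hstar₂ e₁ he₁
    _ ≤ (2 ^ 2 * D) * ((2 ^ (b + 2) * D) * (2 ^ (2 * b + 2) * (D / (p * #V)))) := by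
        rw [← sum_mul]
        gcongr
    _ = 2 ^ (3 * b + 7) * D ^ 3 / (p * #V) / 2 := by
        field_simp
        ring
    _ ≤ 1 / 2 := by
        gcongr
        exact (div_le_one hm0).2 hDm

end LocalSparsity

section GlobalInequality

variable {α : Type*} [DecidableEq α] {E : Finset (Finset α)} {U V A : Finset α} {v : α}
  {p L : ℝ} {a b d : ℕ}

theorem sum_card_linkIn_le (hE : (E : Set (Finset α)).Sized (b + 1))
    (hd : ∀ R, #R = b → codegree E R ≤ d) (A W : Finset α) :
    ∑ v ∈ A, #(linkIn E v W) ≤ #W ^ b * d := by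
  calc ∑ v ∈ A, #(linkIn E v W) ≤ ∑ R ∈ W.powersetCard b, codegree E R := by
        simp only [codegree, ← card_sigma]
        refine card_le_card_of_injOn (fun x => ⟨x.2.erase x.1, x.2⟩) ?_ ?_
        · rintro ⟨v, e⟩ h
          have he := (mem_sigma.1 h).2
          simp only [coe_sigma, Set.mem_sigma_iff, mem_coe, mem_filter, mem_powersetCard]
          exact ⟨⟨(mem_linkIn.1 he).2.2, card_erase_of_mem_linkIn hE he⟩, (mem_linkIn.1 he).1,
            erase_subset _ _⟩
        · rintro ⟨v, e⟩ h ⟨v', e'⟩ h' heq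
          simp only [Sigma.mk.injEq, heq_eq_eq] at heq
          obtain ⟨herase, rfl⟩ := heq
          have hv' := (mem_linkIn.1 (mem_sigma.1 h').2).2.1
          obtain rfl : v = v' := erase_injOn e (mem_linkIn.1 (mem_sigma.1 h).2).2.1 hv' herase
          rfl
    _ ≤ #(W.powersetCard b) • d :=
        sum_le_card_nsmul _ _ d fun R hR => hd R (mem_powersetCard.1 hR).2
    _ ≤ #W ^ b * d := by
        rw [card_powersetCard, smul_eq_mul]
        exact Nat.mul_le_mul_right _ (Nat.choose_le_pow _ _)

theorem sum_meanLink_le (hE : (E : Set (Finset α)).Sized (b + 1))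
    (hd : ∀ R, #R = b → codegree E R ≤ d) (ha : ∀ W ∈ indepSets E U, #W ≤ a) (A : Finset α) :
    ∑ v ∈ A, meanLink E U v ≤ a ^ b * d := by
  have hempty : ∅ ∉ E := fun h => by simpa using hE h
  simp only [meanLink, ← expect_sum_comm]
  refine expect_le (indepSets_nonempty hempty) fun W hW => ?_
  exact_mod_cast (sum_card_linkIn_le hE hd A W).trans
    (Nat.mul_le_mul_right d (Nat.pow_le_pow_left (ha W hW) b))

theorem le_sum_extensionProb (hb : 1 ≤ b) (hE : (E : Set (Finset α)).Sized (b + 1))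
    (hd : ∀ R, #R = b → codegree E R ≤ d) (ha : ∀ W ∈ indepSets E U, #W ≤ a)
    (hA : ∀ v ∈ A, LocallySparse E U v) (L : ℝ) :
    Real.exp (-L) * ((1 + L) * #A - linkConst b * (a ^ b * d)) ≤
      ∑ v ∈ A, extensionProb E U v := by
  calc Real.exp (-L) * ((1 + L) * #A - linkConst b * (a ^ b * d))
      ≤ Real.exp (-L) * ((1 + L) * #A - linkConst b * ∑ v ∈ A, meanLink E U v) := by
        have hκ := linkConst_pos hb
        gcongr
        exact sum_meanLink_le hE hd ha A
    _ = ∑ v ∈ A, Real.exp (-L) * (1 + L - linkConst b * meanLink E U v) := by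
        rw [← mul_sum, sum_sub_distrib, sum_const, ← mul_sum, nsmul_eq_mul, mul_comm (1 + L)]
    _ ≤ ∑ v ∈ A, extensionProb E U v := sum_le_sum fun v hv => le_extensionProb hb hE (hA v hv) L

theorem quarter_le_bernoulliProb_locallySparse (hv : v ∈ V) (hp : p ≤ 1 / 4)
    (h : bernoulliProb p V (fun U => v ∉ U ∧ ¬ LocallySparse E U v) ≤ 1 / 2) :
    1 / 4 ≤ bernoulliProb p V (fun U => v ∉ U ∧ LocallySparse E U v) := by
  have hmem := bernoulliProb_superset (p := p) (singleton_subset_iff.2 hv)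
  have hsplit : bernoulliProb p V (fun U => v ∉ U ∧ LocallySparse E U v) =
      1 - bernoulliProb p V ({v} ⊆ ·) -
        bernoulliProb p V (fun U => v ∉ U ∧ ¬ LocallySparse E U v) := by
    rw [← bernoulliExpect_const (p := p) (V := V) 1]
    simp only [bernoulliProb, ← bernoulliExpect_sub, singleton_subset_iff]
    congr 1
    ext U
    by_cases hvU : v ∈ U <;> by_cases hs : LocallySparse E U v <;> simp [hvU, hs]
  rw [card_singleton, pow_one] at hmem
  linarith

theorem quarter_card_le_bernoulliExpect_card (hp : p ≤ 1 / 4)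
    (hs : ∀ v ∈ V, bernoulliProb p V (fun U => v ∉ U ∧ ¬ LocallySparse E U v) ≤ 1 / 2) :
    #V / 4 ≤ bernoulliExpect p V (fun U => (#{v ∈ V \ U | LocallySparse E U v} : ℝ)) := by
  have hcard (U : Finset α) : (#{v ∈ V \ U | LocallySparse E U v} : ℝ) =
      ∑ v ∈ V, if v ∉ U ∧ LocallySparse E U v then 1 else 0 := by
    rw [← natCast_card_filter, ← filter_filter, filter_notMem_eq_sdiff]
  simp only [hcard, bernoulliExpect_sum]
  rw [div_eq_mul_one_div, ← nsmul_eq_mul]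
  exact card_nsmul_le_sum _ _ _ fun v hv => quarter_le_bernoulliProb_locallySparse hv hp (hs v hv)

theorem card_mul_one_add_le (hb : 1 ≤ b) (hE : (E : Set (Finset α)).Sized (b + 1))
    (hd : ∀ R, #R = b → codegree E R ≤ d) (ha : ∀ W ∈ indepSets E V, #W ≤ a) (hp : 0 < p)
    (hp4 : p ≤ 1 / 4)
    (hs : ∀ v ∈ V, bernoulliProb p V (fun U => v ∉ U ∧ ¬ LocallySparse E U v) ≤ 1 / 2)
    (hL : 0 ≤ L) :
    #V / 4 * (1 + L) - linkConst b * (a ^ b * d) ≤ Real.exp L * (2 * a / p) := by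
  have hempty : ∅ ∉ E := fun h => by simpa using hE h
  have hp1 : p ≤ 1 := by linarith
  have haU {U} (hU : U ⊆ V) : ∀ W ∈ indepSets E U, #W ≤ a := fun W hW =>
    ha W (mem_indepSets.2 ⟨(mem_indepSets.1 hW).1.trans hU, (mem_indepSets.1 hW).2⟩)
  have hlower : Real.exp (-L) * ((1 + L) * (#V / 4) - linkConst b * (a ^ b * d)) ≤
      bernoulliExpect p V (fun U => ∑ v ∈ V \ U, extensionProb E U v) := by
    calc Real.exp (-L) * ((1 + L) * (#V / 4) - linkConst b * (a ^ b * d))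
        ≤ Real.exp (-L) * ((1 + L) *
            bernoulliExpect p V (fun U => (#{v ∈ V \ U | LocallySparse E U v} : ℝ)) -
            linkConst b * (a ^ b * d)) := by
          gcongr
          exact quarter_card_le_bernoulliExpect_card hp4 hs
      _ = bernoulliExpect p V (fun U => Real.exp (-L) *
            ((1 + L) * #{v ∈ V \ U | LocallySparse E U v} - linkConst b * (a ^ b * d))) := by
          rw [bernoulliExpect_const_mul, bernoulliExpect_sub, bernoulliExpect_const_mul,
            bernoulliExpect_const]
      _ ≤ bernoulliExpect p V (fun U => ∑ v ∈ V \ U, extensionProb E U v) :=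
          bernoulliExpect_mono hp.le hp1 fun U hU =>
            (le_sum_extensionProb hb hE hd (haU hU) (fun v hv => (mem_filter.1 hv).2) L).trans <|
              sum_le_sum_of_subset_of_nonneg (filter_subset _ _) fun _ _ _ => extensionProb_nonneg
  have hupper : bernoulliExpect p V (fun U => ∑ v ∈ V \ U, extensionProb E U v) ≤ 2 * a / p := by
    rw [le_div_iff₀' hp]
    exact bernoulliExpect_sum_extensionProb_le hempty hp.le hp1 ha
  have hmul := mul_le_mul_of_nonneg_left (hlower.trans hupper) (Real.exp_pos L).le
  rw [← mul_assoc, ← Real.exp_add, add_neg_cancel, Real.exp_zero, one_mul] at hmul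
  rwa [mul_comm (#V / 4 : ℝ)]

theorem card_div_four_mul_le (hb : 1 ≤ b) (hE : (E : Set (Finset α)).Sized (b + 1))
    (hd : ∀ R, #R = b → codegree E R ≤ d) (ha : ∀ W ∈ indepSets E V, #W ≤ a) (hp : 0 < p)
    (hp4 : p ≤ 1 / 4)
    (hs : ∀ v ∈ V, bernoulliProb p V (fun U => v ∉ U ∧ ¬ LocallySparse E U v) ≤ 1 / 2)
    (hL : 0 ≤ L) (hLp : 8 * (Real.exp L * a) ≤ p * #V) :
    #V / 4 * L ≤ linkConst b * (a ^ b * d) := by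
  have hbound : Real.exp L * (2 * a / p) ≤ #V / 4 := by
    rw [mul_div_assoc', div_le_iff₀ hp]
    linarith
  linarith [card_mul_one_add_le hb hE hd ha hp hp4 hs hL]

end GlobalInequality

section Parameters

open Filter Real

variable {s t x : ℝ}

theorem eventually_mul_rpow_mul_log_pow_le (K : ℝ) (j : ℕ) (hst : s < t) :
    ∀ᶠ x : ℝ in atTop, K * (x ^ s * log x ^ j) ≤ x ^ t := by
  have hlog := (isLittleO_log_rpow_rpow_atTop (j : ℝ) (sub_pos.2 hst)).bound
    (c := 1 / (|K| + 1)) (by positivity)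
  filter_upwards [hlog, eventually_ge_atTop 1] with x hlog hx
  have hx0 : 0 < x := by linarith
  have hlog0 : 0 ≤ log x := log_nonneg hx
  rw [rpow_natCast, norm_of_nonneg (by positivity), norm_of_nonneg (by positivity),
    one_div_mul_eq_div, le_div_iff₀' (by positivity)] at hlog
  calc K * (x ^ s * log x ^ j) ≤ (|K| + 1) * (x ^ s * log x ^ j) := by
        gcongr
        linarith [le_abs_self K]
    _ = x ^ s * ((|K| + 1) * log x ^ j) := by ring
    _ ≤ x ^ s * x ^ (t - s) := by gcongr
    _ = x ^ t := by rw [← rpow_add hx0, add_sub_cancel]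

theorem rpow_le_mul_log_rpow (hx : 0 ≤ x) (hlog : 1 ≤ log x) (hs : 0 ≤ s) :
    x ^ s ≤ (x * log x) ^ s :=
  rpow_le_rpow hx (le_mul_of_one_le_right hx hlog) hs

theorem mul_log_rpow_le (hx : 0 ≤ x) (hlog : 1 ≤ log x) (hs : s ≤ 1) :
    (x * log x) ^ s ≤ x ^ s * log x := by
  rw [mul_rpow hx (by linarith)]
  exact mul_le_mul_of_nonneg_left (rpow_le_self_of_one_le hlog hs) (by positivity)

theorem eventually_four_mul_rpow_mul_mul_log_rpow_le (hs : s ≤ 1) (hst : t + s < 1) :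
    ∀ᶠ x : ℝ in atTop, 4 * (x ^ t * (x * log x) ^ s) ≤ x := by
  filter_upwards [eventually_mul_rpow_mul_log_pow_le 4 1 hst, eventually_gt_atTop 0,
    tendsto_log_atTop.eventually_ge_atTop 1] with x hbound hx hlog
  calc 4 * (x ^ t * (x * log x) ^ s) ≤ 4 * (x ^ t * (x ^ s * log x)) := by
        gcongr
        exact mul_log_rpow_le hx.le hlog hs
    _ = 4 * (x ^ (t + s) * log x ^ 1) := by rw [rpow_add hx, pow_one, mul_assoc]
    _ ≤ x := by rwa [rpow_one] at hbound

theorem eventually_mul_pow_le_rpow_mul_mul_log_rpow (K : ℝ) (b j : ℕ) (ht : 0 ≤ t) (hs : 0 ≤ s)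
    (hts : t * b * j < s) :
    ∀ᶠ x : ℝ in atTop, K * ((x ^ t) ^ b * log x) ^ j ≤ x ^ t * (x * log x) ^ s := by
  filter_upwards [eventually_mul_rpow_mul_log_pow_le K j hts, eventually_ge_atTop 1,
    tendsto_log_atTop.eventually_ge_atTop 1] with x hbound hx hlog
  have hx0 : 0 ≤ x := by linarith
  calc K * ((x ^ t) ^ b * log x) ^ j = K * (x ^ (t * b * j) * log x ^ j) := by
        rw [mul_pow, rpow_mul_natCast hx0, rpow_mul_natCast hx0]
    _ ≤ x ^ s := hbound
    _ ≤ (x * log x) ^ s := rpow_le_mul_log_rpow hx0 hlog hs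
    _ ≤ x ^ t * (x * log x) ^ s :=
        le_mul_of_one_le_left (by positivity) (one_le_rpow hx ht)

theorem exists_pos_eventually_four_mul_le_and_mul_pow_le (K : ℝ) {b : ℕ} (hb : 1 ≤ b) :
    ∃ δ : ℝ, 0 < δ ∧ ∀ᶠ x : ℝ in atTop,
      4 * (x ^ δ * (x * log x) ^ (1 / (b + 1 : ℕ) : ℝ)) ≤ x ∧
      K * ((x ^ δ) ^ b * log x) ^ 3 ≤ x ^ δ * (x * log x) ^ (1 / (b + 1 : ℕ) : ℝ) := by
  set s : ℝ := 1 / (b + 1 : ℕ)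
  have hs : 0 < s := by positivity
  have hs2 : s ≤ 1 / 2 := one_div_le_one_div_of_le two_pos (by exact_mod_cast Nat.succ_le_succ hb)
  have hbs : s * (b + 1) = 1 := by
    simp only [s, Nat.cast_add_one]
    exact one_div_mul_cancel (by positivity)
  have hδs : s ^ 2 / 3 + s < 1 := by nlinarith
  have hδb : s ^ 2 / 3 * b * (3 : ℕ) < s := by
    calc s ^ 2 / 3 * b * (3 : ℕ) = s * (s * b) := by
          push_cast
          ring
      _ < s * 1 := by
          gcongr
          linarith
      _ = s := mul_one s
  exact ⟨s ^ 2 / 3, by positivity, (eventually_four_mul_rpow_mul_mul_log_rpow_le (by linarith)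
    hδs).and (eventually_mul_pow_le_rpow_mul_mul_log_rpow K b 3 (by positivity) hs.le hδb)⟩

theorem exists_pos_forall_lt_mul_le_one {c₀ : ℝ} (hc₀ : 0 < c₀) (f : ℕ → ℝ) (N : ℕ) :
    ∃ c, 0 < c ∧ c ≤ c₀ ∧ ∀ n < N, c * f n ≤ 1 := by
  have hM : 0 < ∑ n ∈ range N, |f n| + 1 := by positivity
  refine ⟨min c₀ (1 / (∑ n ∈ range N, |f n| + 1)), by positivity, min_le_left _ _, fun n hn => ?_⟩
  have hf : |f n| ≤ ∑ n ∈ range N, |f n| :=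
    single_le_sum (f := fun n => |f n|) (fun _ _ => abs_nonneg _) (mem_range.2 hn)
  calc min c₀ (1 / (∑ n ∈ range N, |f n| + 1)) * f n
      ≤ 1 / (∑ n ∈ range N, |f n| + 1) * |f n| := by
        exact mul_le_mul_of_nonneg (min_le_right _ _) (le_abs_self _) (by positivity)
          (abs_nonneg _)
    _ ≤ 1 := by
        rw [one_div_mul_eq_div, div_le_one hM]
        linarith

end Parameters

section IndependenceNumber

open Filter

variable {α : Type*} [DecidableEq α] {E : Finset (Finset α)} {V : Finset α} {a b : ℕ} {δ : ℝ}

theorem bernoulliProb_not_locallySparse_le_half_of_one_le {p D : ℝ} (hb : 1 ≤ b)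
    (hE : (E : Set (Finset α)).Sized (b + 1)) (hEV : ∀ e ∈ E, e ⊆ V)
    (hd : ∀ R, #R = b → codegree E R ≤ a)
    (hsparse : b = 1 → ∀ U v, LocallySparse E U v) (hp : 0 ≤ p) (hp1 : p ≤ 1)
    (hD1 : 1 ≤ D) (hD : p * a * (p * #V) ^ (b - 1) ≤ D)
    (hDm : 2 ^ (3 * b + 7) * D ^ 3 ≤ p * #V) (v : α) :
    bernoulliProb p V (fun U => v ∉ U ∧ ¬ LocallySparse E U v) ≤ 1 / 2 := by
  obtain rfl | hb2 := hb.eq_or_lt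
  · calc bernoulliProb p V (fun U => v ∉ U ∧ ¬ LocallySparse E U v)
        = bernoulliExpect p V fun _ => 0 := by
          rw [bernoulliProb]
          refine congrArg _ (funext fun U => ?_)
          rw [if_neg fun h => h.2 (hsparse rfl U v)]
      _ ≤ 1 / 2 := by
          rw [bernoulliExpect_const]
          norm_num
  · exact bernoulliProb_not_locallySparse_le_half hb2 hE hEV hd hp hp1 hD1 hD hDm

-- The random set has expected size `x ^ δ * w`, where `x = #V` and `w = (x log x) ^ (1 / (b + 1))`.
theorem mul_card_mul_log_le_pow (hb : 1 ≤ b) (hE : (E : Set (Finset α)).Sized (b + 1))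
    (hEV : ∀ e ∈ E, e ⊆ V) (hd : ∀ R, #R = b → codegree E R ≤ a)
    (ha : ∀ W ∈ indepSets E V, #W ≤ a)
    (hsparse : b = 1 → ∀ U v, LocallySparse E U v) (hδ : 0 ≤ δ) {x w : ℝ} (hx : #V = x)
    (hlog : 1 ≤ Real.log x) (hw : 0 < w) (hwx : w ^ (b + 1) = x * Real.log x)
    (hp : 4 * (x ^ δ * w) ≤ x)
    (hD : 2 ^ (3 * b + 7) * ((x ^ δ) ^ b * Real.log x) ^ 3 ≤ x ^ δ * w) (haw : 8 * a ≤ w) :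
    δ / (4 * linkConst b) * (x * Real.log x) ≤ a ^ (b + 1) := by
  have hx0 : 0 < x := by
    refine (hx ▸ Nat.cast_nonneg #V : 0 ≤ x).lt_of_ne fun h => ?_
    norm_num [← h] at hlog
  have hx1 : 1 ≤ x := by linarith [Real.log_le_sub_one_of_pos hx0]
  have hxδ : 1 ≤ x ^ δ := Real.one_le_rpow hx1 hδ
  have hpx : x ^ δ * w / x * x = x ^ δ * w := div_mul_cancel₀ _ hx0.ne'
  have hp4 : x ^ δ * w / x ≤ 1 / 4 := by
    rw [div_le_iff₀ hx0]
    linarith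
  have hpD : x ^ δ * w / x * a * (x ^ δ * w) ^ (b - 1) ≤ (x ^ δ) ^ b * Real.log x := by
    calc x ^ δ * w / x * a * (x ^ δ * w) ^ (b - 1)
        ≤ x ^ δ * w / x * w * (x ^ δ * w) ^ (b - 1) := by
          gcongr
          linarith [Nat.cast_nonneg (α := ℝ) a]
      _ = (x ^ δ) ^ (b - 1 + 1) * w ^ (b - 1 + 1 + 1) / x := by ring
      _ = (x ^ δ) ^ b * Real.log x := by
          rw [Nat.sub_add_cancel hb, hwx]
          field_simp
  have hfail (v : α) : bernoulliProb (x ^ δ * w / x) V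
      (fun U => v ∉ U ∧ ¬ LocallySparse E U v) ≤ 1 / 2 :=
    bernoulliProb_not_locallySparse_le_half_of_one_le (D := (x ^ δ) ^ b * Real.log x) hb hE hEV hd
      hsparse (by positivity) (by linarith)
      (one_le_mul_of_one_le_of_one_le (one_le_pow₀ hxδ) hlog) (by rwa [hx, hpx])
      (by rwa [hx, hpx]) v
  have hmain := card_div_four_mul_le hb hE hd ha (by positivity) hp4 (fun v _ => hfail v)
    (mul_nonneg (Real.log_nonneg hx1) hδ) (by
      rw [← Real.rpow_def_of_pos hx0, hx, hpx, mul_left_comm]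
      gcongr)
  rw [hx, ← pow_succ] at hmain
  have hκ := linkConst_pos hb
  rw [div_mul_eq_mul_div, div_le_iff₀ (by positivity)]
  linarith

theorem exists_eventually_const_le_of_codegree_le (hb : 1 ≤ b) :
    ∃ c : ℝ, 0 < c ∧ ∀ᶠ n : ℕ in atTop, ∀ {α : Type*} [DecidableEq α] (E : Finset (Finset α))
      (V : Finset α) (a : ℕ), (E : Set (Finset α)).Sized (b + 1) → (∀ e ∈ E, e ⊆ V) →
      (∀ R, #R = b → codegree E R ≤ a) → (∀ W ∈ indepSets E V, #W ≤ a) →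
      (b = 1 → ∀ U v, LocallySparse E U v) → #V = n →
      c * ((n : ℝ) * Real.log n) ^ (1 / (b + 1 : ℕ) : ℝ) ≤ a := by
  obtain ⟨δ, hδ, hparam⟩ := exists_pos_eventually_four_mul_le_and_mul_pow_le (2 ^ (3 * b + 7)) hb
  set s : ℝ := 1 / (b + 1 : ℕ)
  have hκ := linkConst_pos hb
  refine ⟨min (1 / 8) ((δ / (4 * linkConst b)) ^ s), by positivity, ?_⟩
  filter_upwards [tendsto_natCast_atTop_atTop.eventually hparam,
    (Real.tendsto_log_atTop.comp tendsto_natCast_atTop_atTop).eventually_ge_atTop 1]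
    with n ⟨hp, hD⟩ hlog α _ E V a hE hEV hd ha hsparse hV
  change 1 ≤ Real.log n at hlog
  have hn : 0 < (n : ℝ) * Real.log n := by
    have hn0 : n ≠ 0 := by
      rintro rfl
      norm_num at hlog
    positivity
  by_cases haw : 8 * a ≤ ((n : ℝ) * Real.log n) ^ s
  · have hpow := mul_card_mul_log_le_pow hb hE hEV hd ha hsparse hδ.le (congrArg Nat.cast hV)
      hlog (by positivity)
      (by simp only [s, one_div]; exact Real.rpow_inv_natCast_pow hn.le b.succ_ne_zero) hp hD haw
    calc min (1 / 8) ((δ / (4 * linkConst b)) ^ s) * ((n : ℝ) * Real.log n) ^ s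
        ≤ (δ / (4 * linkConst b)) ^ s * ((n : ℝ) * Real.log n) ^ s := by
          gcongr
          exact min_le_right _ _
      _ = (δ / (4 * linkConst b) * ((n : ℝ) * Real.log n)) ^ s :=
          (Real.mul_rpow (by positivity) hn.le).symm
      _ ≤ ((a : ℝ) ^ (b + 1)) ^ s := by gcongr
      _ = a := by
          simp only [s, one_div]
          exact Real.pow_rpow_inv_natCast a.cast_nonneg b.succ_ne_zero
  · calc min (1 / 8) ((δ / (4 * linkConst b)) ^ s) * ((n : ℝ) * Real.log n) ^ s
        ≤ 1 / 8 * ((n : ℝ) * Real.log n) ^ s := by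
          gcongr
          exact min_le_left _ _
      _ ≤ a := by linarith

theorem one_le_of_forall_mem_indepSets_card_le (hb : 1 ≤ b)
    (hE : (E : Set (Finset α)).Sized (b + 1)) (hV : V.Nonempty)
    (ha : ∀ W ∈ indepSets E V, #W ≤ a) : 1 ≤ a := by
  obtain ⟨v, hv⟩ := hV
  rw [← card_singleton v]
  refine ha {v} (mem_indepSets.2 ⟨singleton_subset_iff.2 hv, fun e he h => ?_⟩)
  have hcard := card_le_card h
  rw [hE he, card_singleton] at hcard
  lia

theorem exists_const_le_of_codegree_le (hb : 1 ≤ b) :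
    ∃ c : ℝ, 0 < c ∧ ∀ {α : Type*} [DecidableEq α] (E : Finset (Finset α))
      (V : Finset α) (a : ℕ), (E : Set (Finset α)).Sized (b + 1) → (∀ e ∈ E, e ⊆ V) →
      (∀ R, #R = b → codegree E R ≤ a) → (∀ W ∈ indepSets E V, #W ≤ a) →
      (b = 1 → ∀ U v, LocallySparse E U v) →
      c * (#V * Real.log #V) ^ (1 / (b + 1 : ℕ) : ℝ) ≤ a := by
  obtain ⟨c₀, hc₀, hlarge⟩ := exists_eventually_const_le_of_codegree_le hb
  obtain ⟨N, hN⟩ := eventually_atTop.1 hlarge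
  obtain ⟨c, hc, hcc₀, hsmall⟩ := exists_pos_forall_lt_mul_le_one hc₀
    (fun n : ℕ => ((n : ℝ) * Real.log n) ^ (1 / (b + 1 : ℕ) : ℝ)) N
  refine ⟨c, hc, fun E V a hE hEV hd ha hsparse => ?_⟩
  obtain hn | hn := lt_or_ge #V N
  · obtain rfl | hV := V.eq_empty_or_nonempty
    · have hs : (1 / (b + 1 : ℕ) : ℝ) ≠ 0 := by positivity
      rw [card_empty, Nat.cast_zero, zero_mul, Real.zero_rpow hs, mul_zero]
      exact a.cast_nonneg
    · exact (hsmall _ hn).trans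
        (Nat.one_le_cast.2 (one_le_of_forall_mem_indepSets_card_le hb hE hV ha))
  · refine (mul_le_mul_of_nonneg_right hcc₀ ?_).trans (hN _ hn E V a hE hEV hd ha hsparse rfl)
    positivity

end IndependenceNumber

end FinsetFamily

namespace RGraph

open Hypergraph

section NeighborhoodCharacterization

variable {α : Type*} {H : Hypergraph α} {r : ℕ} {R : Set α} {x : α}

theorem mem_nbhd_iff (hr : 1 ≤ r) (hH : H.IsRGraph r) (hR : R.ncard = r - 1) :
    x ∈ H.nbhd R ↔ x ∉ R ∧ insert x R ∈ E(H) := by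
  refine ⟨fun ⟨e, he, hRe, hxe, hxR⟩ => ⟨hxR, ?_⟩, fun ⟨hxR, he⟩ =>
    ⟨_, he, Set.subset_insert _ _, Set.mem_insert _ _, hxR⟩⟩
  have hRfin : R.Finite := (hH.1.subset he.subset_vertexSet).subset hRe
  obtain ⟨y, -, rfl⟩ := (Set.exists_eq_insert_iff_ncard hRfin).2
    ⟨hRe, by rw [hR, hH.2 e he, Nat.sub_add_cancel hr]⟩
  rwa [hxe.resolve_right hxR]

theorem nbhd_subset_vertexSet : H.nbhd R ⊆ V(H) := fun _ ⟨_, he, _, hx⟩ =>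
  he.subset_vertexSet hx.1

theorem not_hasIndepNbhds_iff (hr : 1 ≤ r) (hH : H.IsRGraph r) :
    ¬ H.HasIndepNbhds r ↔ ∃ R ⊆ V(H), R.ncard = r - 1 ∧
      ∃ e ∈ E(H), ∀ x ∈ e, x ∉ R ∧ insert x R ∈ E(H) := by
  simp only [HasIndepNbhds, IsIndepSet, nbhd_subset_vertexSet, true_and, not_forall, not_not,
    exists_prop]
  refine exists_congr fun R => and_congr_right fun _ => and_congr_right fun hR =>
    exists_congr fun e => and_congr_right fun _ => ?_
  exact forall₂_congr fun x _ => mem_nbhd_iff hr hH hR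

theorem mem_edgeSet_T_iff (hr : 1 ≤ r) {e : Set (Fin r ⊕ Fin (r - 1))} :
    e ∈ E(T r) ↔ (∃ i, insert (Sum.inl i) (Set.range Sum.inr) = e) ∨ Set.range Sum.inl = e := by
  have hcard : (Set.range (Sum.inr : Fin (r - 1) → Fin r ⊕ Fin (r - 1))).ncard + 1 = r := by
    rw [Set.ncard_range_of_injective Sum.inr_injective, Nat.card_fin, Nat.sub_add_cancel hr]
  have hinsert := Set.exists_eq_insert_iff_ncard
    (Set.finite_range (Sum.inr : Fin (r - 1) → Fin r ⊕ Fin (r - 1))) (t := e)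
  rw [hcard] at hinsert
  simp only [Sum.exists, Set.mem_range, reduceCtorEq, exists_false, not_false_eq_true, true_and,
    Sum.inr.injEq, exists_eq, not_true_eq_false, false_and, or_false] at hinsert
  rw [hinsert, eq_comm (b := e), and_comm, eq_comm (a := r)]
  rfl

theorem exists_injective_range_eq {s : Set α} {n : ℕ} (hs : s.Finite) (hn : s.ncard = n) :
    ∃ g : Fin n → α, Function.Injective g ∧ Set.range g = s := by
  obtain ⟨m, g, hg, rfl⟩ := hs.fin_param
  rw [Set.ncard_range_of_injective hg, Nat.card_fin] at hn
  subst hn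
  exact ⟨g, hg, rfl⟩

theorem contains_T_iff (hr : 1 ≤ r) (hH : H.IsRGraph r) :
    H.Contains (T r) ↔ ∃ R ⊆ V(H), R.ncard = r - 1 ∧
      ∃ e ∈ E(H), ∀ x ∈ e, x ∉ R ∧ insert x R ∈ E(H) := by
  constructor
  · rintro ⟨f, hf, hV, hE⟩
    have hfinj : Function.Injective f := Set.injOn_univ.1 hf
    have hedge {e} (he : e ∈ E(T r)) : f '' e ∈ E(H) := hE ⟨e, he, rfl⟩
    refine ⟨f '' Set.range Sum.inr, ?_, ?_, f '' Set.range Sum.inl,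
      hedge ((mem_edgeSet_T_iff hr).2 (.inr rfl)), ?_⟩
    · exact (Set.image_mono (Set.subset_univ _)).trans hV
    · rw [Set.ncard_image_of_injective _ hfinj, Set.ncard_range_of_injective Sum.inr_injective,
        Nat.card_fin]
    · rintro _ ⟨_, ⟨i, rfl⟩, rfl⟩
      rw [hfinj.mem_set_image, ← Set.image_insert_eq]
      exact ⟨by simp, hedge ((mem_edgeSet_T_iff hr).2 (.inl ⟨i, rfl⟩))⟩
  · rintro ⟨R, hRV, hR, e, he, hRe⟩
    obtain ⟨g, hg, rfl⟩ := exists_injective_range_eq (hH.1.subset he.subset_vertexSet) (hH.2 e he)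
    obtain ⟨g', hg', rfl⟩ := exists_injective_range_eq (hH.1.subset hRV) hR
    have hfinj : Function.Injective (Sum.elim g g') :=
      hg.sumElim hg' fun i j hij => (hRe (g i) ⟨i, rfl⟩).1 ⟨j, hij.symm⟩
    refine ⟨Sum.elim g g', hfinj.injOn, ?_, ?_⟩
    · rintro _ ⟨i | j, -, rfl⟩
      · exact he.subset_vertexSet ⟨i, rfl⟩
      · exact hRV ⟨j, rfl⟩
    · rintro _ ⟨e', he', rfl⟩
      obtain ⟨i, rfl⟩ | rfl := (mem_edgeSet_T_iff hr).1 he'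
      · rw [Set.image_insert_eq, ← Set.range_comp]
        exact (hRe (g i) ⟨i, rfl⟩).2
      · rwa [← Set.range_comp]

theorem hasIndepNbhds_iff_not_contains_T (hr : 1 ≤ r) (hH : H.IsRGraph r) :
    H.HasIndepNbhds r ↔ ¬ H.Contains (T r) := by
  rw [contains_T_iff hr hH, ← not_hasIndepNbhds_iff hr hH, not_not]

end NeighborhoodCharacterization

section IndependenceNumber

open FinsetFamily

variable {α : Type*} {H : Hypergraph α} {r : ℕ} {V W R : Finset α}

theorem ncard_le_indepNum (hV : V(H).Finite) {Z : Set α} (hZ : H.IsIndepSet Z) :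
    Z.ncard ≤ H.indepNum := by
  refine le_csSup ⟨V(H).ncard, ?_⟩ ⟨Z, hZ, rfl⟩
  rintro k ⟨Z', hZ', rfl⟩
  exact Set.ncard_le_ncard hZ'.1 hV

theorem exists_isIndepSet_ncard_eq_indepNum (hV : V(H).Finite) (hE : ∅ ∉ E(H)) :
    ∃ Z, H.IsIndepSet Z ∧ Z.ncard = H.indepNum := by
  refine Nat.sSup_mem (s := {k : ℕ | ∃ Z : Set α, H.IsIndepSet Z ∧ Z.ncard = k})
    ⟨0, ∅, ⟨Set.empty_subset _, fun e he h => hE (Set.subset_empty_iff.1 h ▸ he)⟩,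
      Set.ncard_empty α⟩ ⟨V(H).ncard, ?_⟩
  rintro k ⟨Z, hZ, rfl⟩
  exact Set.ncard_le_ncard hZ.1 hV

open Classical in
/-- The edges of `H` inside the finite set `V`, as a family of finsets. It contains all edges of
`H` when `V` is the vertex set. -/
noncomputable def edgeFamily (H : Hypergraph α) (V : Finset α) : Finset (Finset α) :=
  {e ∈ V.powerset | (e : Set α) ∈ E(H)}

theorem mem_edgeFamily {e : Finset α} (hV : (V : Set α) = V(H)) :
    e ∈ edgeFamily H V ↔ (e : Set α) ∈ E(H) := by
  classical
  simp only [edgeFamily, Finset.mem_filter, Finset.mem_powerset, and_iff_right_iff_imp]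
  intro he
  exact Finset.coe_subset.1 (hV ▸ he.subset_vertexSet)

theorem edgeFamily_sized (hH : H.IsRGraph r) (hV : (V : Set α) = V(H)) :
    (edgeFamily H V : Set (Finset α)).Sized r := fun e he => by
  rw [← Set.ncard_coe_finset]
  exact hH.2 _ ((mem_edgeFamily hV).1 he)

theorem subset_of_mem_edgeFamily {e : Finset α} (he : e ∈ edgeFamily H V) : e ⊆ V := by
  classical
  exact Finset.mem_powerset.1 (Finset.mem_filter.1 he).1

theorem isIndepSet_of_mem_indepSets [DecidableEq α] (hV : (V : Set α) = V(H))
    (hW : W ∈ indepSets (edgeFamily H V) V) : H.IsIndepSet W := by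
  obtain ⟨hWV, hWE⟩ := mem_indepSets.1 hW
  refine ⟨hV ▸ Finset.coe_subset.2 hWV, fun e he heW => ?_⟩
  lift e to Finset α using W.finite_toSet.subset heW
  exact hWE e ((mem_edgeFamily hV).2 he) (Finset.coe_subset.1 heW)

theorem codegree_edgeFamily_le [DecidableEq α] (hr : 1 ≤ r) (hH : H.IsRGraph r)
    (hN : H.HasIndepNbhds r) (hV : (V : Set α) = V(H)) (hR : R.card = r - 1) :
    codegree (edgeFamily H V) R ≤ H.indepNum := by
  rw [codegree]
  obtain h | ⟨e, he⟩ := ((edgeFamily H V).filter (R ⊆ ·)).eq_empty_or_nonempty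
  · rw [h, Finset.card_empty]
    exact zero_le
  have hRV : R ⊆ V :=
    (Finset.mem_filter.1 he).2.trans (subset_of_mem_edgeFamily (Finset.mem_filter.1 he).1)
  have hind := hN R (hV ▸ Finset.coe_subset.2 hRV) (by rw [Set.ncard_coe_finset, hR])
  have hfin : (H.nbhd R).Finite := hH.1.subset hind.1
  refine le_trans ?_ (ncard_le_indepNum hH.1 hind)
  rw [Set.ncard_eq_toFinset_card _ hfin]
  refine (Finset.card_le_card (t := hfin.toFinset.image (insert · R)) fun e he => ?_).trans
    Finset.card_image_le
  obtain ⟨heE, hRe⟩ := Finset.mem_filter.1 he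
  obtain ⟨x, hx, rfl⟩ := (Finset.exists_eq_insert_iff).2
    ⟨hRe, by rw [hR, edgeFamily_sized hH hV heE, Nat.sub_add_cancel hr]⟩
  refine Finset.mem_image_of_mem _ ((Set.Finite.mem_toFinset _).2 ⟨_, (mem_edgeFamily hV).1 heE,
    Finset.coe_subset.2 hRe, ?_, hx⟩)
  exact Finset.mem_coe.2 (Finset.mem_insert_self x R)

theorem locallySparse_edgeFamily [DecidableEq α] (hH : H.IsRGraph 2)
    (hN : H.HasIndepNbhds 2) (hV : (V : Set α) = V(H)) (U : Finset α) (v : α) :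
    LocallySparse (edgeFamily H V) U v := by
  intro f hf _
  by_contra! hcard
  have hf2 := edgeFamily_sized hH hV hf
  have hlink {z} (hz : z ∈ linkVerts (edgeFamily H V) U v) : v ∈ V(H) ∧ z ∈ H.nbhd {v} := by
    obtain ⟨e, he, hze⟩ := Finset.mem_biUnion.1 hz
    obtain ⟨heE, hve, -⟩ := mem_linkIn.1 he
    have heH := (mem_edgeFamily hV).1 heE
    exact ⟨heH.subset_vertexSet hve, e, heH, Set.singleton_subset_iff.2 hve,
      Finset.mem_of_mem_erase hze, Finset.ne_of_mem_erase hze⟩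
  have hfN : f ⊆ linkVerts (edgeFamily H V) U v :=
    Finset.inter_eq_left.1 (Finset.eq_of_subset_of_card_le Finset.inter_subset_left (by lia))
  obtain ⟨x, hx⟩ := Finset.card_pos.1 (hf2 ▸ two_pos)
  refine (hN {v} (Set.singleton_subset_iff.2 (hlink (hfN hx)).1) (Set.ncard_singleton v)).2 f
    ((mem_edgeFamily hV).1 hf) fun z hz => (hlink (hfN hz)).2

theorem exists_const_le_indepNum (hr : 2 ≤ r) : ∃ c : ℝ, 0 < c ∧
    ∀ (α : Type*) (H : Hypergraph α) (n : ℕ),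
      H.IsRGraph r → V(H).ncard = n → H.HasIndepNbhds r →
        c * ((n : ℝ) * Real.log n) ^ ((1 : ℝ) / r) ≤ (H.indepNum : ℝ) := by
  classical
  obtain ⟨b, rfl⟩ : ∃ b, r = b + 1 := ⟨r - 1, by lia⟩
  obtain ⟨c, hc, h⟩ := exists_const_le_of_codegree_le (b := b) (by lia)
  refine ⟨c, hc, fun α H n hH hn hN => ?_⟩
  obtain ⟨V, hV⟩ := hH.1.exists_finset_coe
  rw [← hn, ← hV, Set.ncard_coe_finset]
  refine h (edgeFamily H V) V H.indepNum (edgeFamily_sized hH hV)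
    (fun _ => subset_of_mem_edgeFamily) (fun R hR => codegree_edgeFamily_le (by lia) hH hN hV hR)
    (fun W hW => ?_) ?_
  · rw [← Set.ncard_coe_finset]
    exact ncard_le_indepNum hH.1 (isIndepSet_of_mem_indepSets hV hW)
  · rintro rfl
    exact locallySparse_edgeFamily hH hN hV

end IndependenceNumber

section RamseyNumber

variable {r N t : ℕ}

theorem isRGraph_colorClass {κ : Type*} (col : E(completeRGraph r N) → κ) (i : κ) :
    ((completeRGraph r N).colorClass col i).IsRGraph r :=
  ⟨Set.toFinite _, fun _ he => he.1⟩

theorem contains_completeRGraph_of_le_indepNum (hr : 1 ≤ r)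
    (col : E(completeRGraph r N) → Bool)
    (ht : t ≤ ((completeRGraph r N).colorClass col true).indepNum) :
    ((completeRGraph r N).colorClass col false).Contains (completeRGraph r t) := by
  have hempty : ∅ ∉ E((completeRGraph r N).colorClass col true) := fun he => by
    have := (isRGraph_colorClass col true).2 ∅ he
    rw [Set.ncard_empty] at this
    lia
  obtain ⟨Z, hZ, hZcard⟩ := exists_isIndepSet_ncard_eq_indepNum (Set.toFinite _) hempty
  obtain ⟨Z', hZ', hZ'card⟩ := Set.exists_subset_card_eq (hZcard ▸ ht)
  obtain ⟨g, hg, rfl⟩ := exists_injective_range_eq (Set.toFinite Z') hZ'card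
  refine ⟨g, hg.injOn, Set.subset_univ _, ?_⟩
  rintro _ ⟨e, he, rfl⟩
  have hedge : g '' e ∈ E(completeRGraph r N) := (Set.ncard_image_of_injective e hg).trans he
  refine ⟨hedge, Bool.eq_false_iff.2 fun hred => ?_⟩
  exact hZ.2 _ ⟨hedge, hred⟩ ((Set.image_subset_range g e).trans hZ')

theorem mem_ramseySet_of_forall_le_indepNum (hr : 1 ≤ r)
    (h : ∀ H : Hypergraph (Fin N), H.IsRGraph r → V(H).ncard = N → H.HasIndepNbhds r →
      t ≤ H.indepNum) :
    N ∈ ramseySet r (T r) (completeRGraph r t) := fun col => by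
  have hred := isRGraph_colorClass col true
  refine or_iff_not_imp_left.2 fun hT => contains_completeRGraph_of_le_indepNum hr col ?_
  refine h _ hred ?_ ((hasIndepNbhds_iff_not_contains_T hr hred).2 hT)
  exact (Set.ncard_univ _).trans (Nat.card_fin N)

theorem le_pow_div_log (hr : 2 ≤ r) {x : ℝ} (hx : 1 < x) : x ≤ x ^ r / Real.log x := by
  rw [le_div_iff₀ (Real.log_pos hx)]
  calc x * Real.log x ≤ x * x := by
        gcongr
        exact Real.log_le_self (by positivity)
    _ = x ^ 2 := (sq x).symm
    _ ≤ x ^ r := pow_le_pow_right₀ hx.le hr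

theorem le_const_mul_rpow_of_pow_div_log_le {c : ℝ} (hc : 0 < c) (hr : 2 ≤ r) (ht : 2 ≤ t)
    (hN : max 1 ((1 / c) ^ r) * ((t : ℝ) ^ r / Real.log t) ≤ N) :
    (t : ℝ) ≤ c * ((N : ℝ) * Real.log N) ^ ((1 : ℝ) / r) := by
  have ht1 : (1 : ℝ) < t := by exact_mod_cast ht
  have hlog : 0 < Real.log t := Real.log_pos ht1
  have htN : (t : ℝ) ≤ N := calc
    (t : ℝ) ≤ (t : ℝ) ^ r / Real.log t := le_pow_div_log hr ht1
    _ ≤ max 1 ((1 / c) ^ r) * ((t : ℝ) ^ r / Real.log t) :=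
      le_mul_of_one_le_left (by positivity) (le_max_left _ _)
    _ ≤ N := hN
  have hpow : ((t : ℝ) / c) ^ r ≤ N * Real.log N := calc
    ((t : ℝ) / c) ^ r = (1 / c) ^ r * ((t : ℝ) ^ r / Real.log t) * Real.log t := by
      rw [mul_assoc, div_mul_cancel₀ _ hlog.ne', ← mul_pow, one_div_mul_eq_div]
    _ ≤ max 1 ((1 / c) ^ r) * ((t : ℝ) ^ r / Real.log t) * Real.log t := by
      gcongr
      exact le_max_right _ _
    _ ≤ N * Real.log N := by gcongr
  rw [← div_le_iff₀' hc, one_div, Real.le_rpow_inv_iff_of_pos (by positivity)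
    ((by positivity : (0 : ℝ) ≤ _).trans hpow) (by positivity), Real.rpow_natCast]
  exact hpow

theorem exists_ramseyNumber_le (hr : 2 ≤ r) : ∃ C : ℝ, 0 < C ∧ ∀ t : ℕ, 2 ≤ t →
    (ramseySet r (T r) (completeRGraph r t)).Nonempty ∧
    (ramseyNumber r (T r) (completeRGraph r t) : ℝ) ≤ C * ((t : ℝ) ^ r / Real.log t) := by
  obtain ⟨c, hc, hα⟩ := exists_const_le_indepNum.{0} hr
  set C : ℝ := max 1 ((1 / c) ^ r)
  have hC : 1 ≤ C := le_max_left _ _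
  refine ⟨2 * C, by positivity, fun t ht => ?_⟩
  have ht1 : (1 : ℝ) < t := by exact_mod_cast ht
  have hX : 1 ≤ (t : ℝ) ^ r / Real.log t := ht1.le.trans (le_pow_div_log hr ht1)
  have hmem : ⌈C * ((t : ℝ) ^ r / Real.log t)⌉₊ ∈ ramseySet r (T r) (completeRGraph r t) :=
    mem_ramseySet_of_forall_le_indepNum (by lia) fun H hH hn hN => by
      exact_mod_cast (le_const_mul_rpow_of_pow_div_log_le hc hr ht (Nat.le_ceil _)).trans
        (hα _ H _ hH hn hN)
  refine ⟨⟨_, hmem⟩, ?_⟩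
  calc (ramseyNumber r (T r) (completeRGraph r t) : ℝ)
      ≤ ⌈C * ((t : ℝ) ^ r / Real.log t)⌉₊ := Nat.cast_le.2 (Nat.sInf_le hmem)
    _ ≤ 2 * (C * ((t : ℝ) ^ r / Real.log t)) := Nat.ceil_le_two_mul (by nlinarith)
    _ = 2 * C * ((t : ℝ) ^ r / Real.log t) := (mul_assoc _ _ _).symm

end RamseyNumber

end RGraph

theorem theorem2 (r : ℕ) (hr : 2 ≤ r) :
    (∀ (α : Type*) (H : Hypergraph α), H.IsRGraph r →
      (H.HasIndepNbhds r ↔ ¬ H.Contains (Hypergraph.T r))) ∧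
    (∃ c : ℝ, 0 < c ∧ ∀ (α : Type*) (H : Hypergraph α) (n : ℕ),
      H.IsRGraph r → H.vertexSet.ncard = n → H.HasIndepNbhds r →
        c * ((n : ℝ) * Real.log n) ^ ((1 : ℝ) / r) ≤ (H.indepNum : ℝ)) ∧
    (∃ C : ℝ, 0 < C ∧ ∀ t : ℕ, 2 ≤ t →
      (Hypergraph.ramseySet r (Hypergraph.T r) (Hypergraph.completeRGraph r t)).Nonempty ∧
      (Hypergraph.ramseyNumber r (Hypergraph.T r) (Hypergraph.completeRGraph r t) : ℝ) ≤
        C * ((t : ℝ) ^ r / Real.log t)) :=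
  ⟨fun _ _ hH => RGraph.hasIndepNbhds_iff_not_contains_T (by lia) hH,
    RGraph.exists_const_le_indepNum hr, RGraph.exists_ramseyNumber_le hr⟩
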